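/- **Theorem 1.2.** Let $k$ be a finitely generated subring of $\bar{\mathbb Q}$ and let $f\colon V\to\operatorname{Spec}k$ be a reduced separated scheme of finite type over $k$. For a finite set $O\subseteq V(k)$ of sections of $f$, let $Z_O$ be the closed subset $\bigcup_{y\in O}y(\operatorname{Spec}k)$ of $V$ with its reduced closed subscheme structure, and let $\operatorname{Aut}(Z_O/k)$ be the group of its automorphisms over $\operatorname{Spec}k$. There is an effective constant $C(V,k)$ such that for every finite set $O\subseteq V(k)$ the group $\operatorname{Aut}(Z_O/k)$ is finite and $$|\operatorname{Aut}(Z_O/k)|\le C(V,k).$$ Here "effective" means the following. An explicit description $D$ of $(V,k)$ is a finite list of integers that consists of * an irreducible polynomial in $\mathbb Z[T]$ with a root $\theta\in\bar{\mathbb Q}$, together with polynomials $g_i\in\mathbb Z[T]$ and integers $d_i>0$ $(1\le i\le m)$ such that $k$ is generated as a ring by $a_i=g_i(\theta)/d_i$, $1\le i\le m$; * a finite affine open covering $V=\bigcup_iU_i$ given by $k$-algebra isomorphisms $\Gamma(V,U_i)\cong k[x_1,\dots,x_{n_i}]/(F_{i,1},\dots,F_{i,r_i})$, where the $F_{i,s}$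 are written as integer polynomials in $a_1,\dots,a_m,x_1,\dots,x_{n_i}$; * for all $i,j$, finitely many basic open subsets $D(h)$ of $U_i$ with union $U_i\cap U_j$, and on each of them an expression of every coordinate of $U_j$ as a fraction $g/h^e$, where $h$ and $g$ are written as integer polynomials in $a_1,\dots,a_m$ and the coordinates of $U_i$, and $e\ge0$ is an integer. Every $(V,k)$ as above has such a description, and there is one algorithm (a computable function $D\mapsto C(D)\in\mathbb N$) such that for every $(V,k)$ as above and every description $D$ of it, $C(V,k)=C(D)$ has the stated property. -/

import Mathlib

open CategoryTheory AlgebraicGeometry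

noncomputable section

/-! ### Configurations of integral points -/

/-- The subrings of `ℚ̄` are regarded as subrings of Mathlib's algebraic closure of `ℚ`. -/
abbrev QBar : Type := AlgebraicClosure ℚ

/-- The affine scheme `Spec k` of a subring `k` of `ℚ̄`. -/
abbrev specOf (k : Subring QBar) : Scheme.{0} := Spec (CommRingCat.of k)

/-- The set `V(k)` of `k`-points of a `k`-scheme `f : V ⟶ Spec k`, that is, of sections of `f`. -/
def KPoints {k : Subring QBar} {V : Scheme.{0}} (f : V ⟶ specOf k) : Type :=
  {y : specOf k ⟶ V // y ≫ f = 𝟙 _}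

/-- The closed subset underlying `Z_O`: the closure of the union of the images of the sections
`y ∈ O`.  If `f` is separated and `O` is finite, the union is closed already,
see `coe_configClosed`. -/
def configClosed {k : Subring QBar} {V : Scheme.{0}} (f : V ⟶ specOf k) (O : Set (KPoints f)) :
    TopologicalSpace.Closeds V :=
  TopologicalSpace.Closeds.closure (⋃ y ∈ O, Set.range y.1)

/-- The closed subscheme `Z_O` of `V`, with its reduced structure. -/
def config {k : Subring QBar} {V : Scheme.{0}} (f : V ⟶ specOf k) (O : Set (KPoints f)) :
    Scheme.{0} :=
  (Scheme.IdealSheafData.vanishingIdeal (configClosed f O)).subscheme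

/-- The structure morphism `Z_O ⟶ V ⟶ Spec k`. -/
def configHom {k : Subring QBar} {V : Scheme.{0}} (f : V ⟶ specOf k) (O : Set (KPoints f)) :
    config f O ⟶ specOf k :=
  (Scheme.IdealSheafData.vanishingIdeal (configClosed f O)).subschemeι ≫ f

/-- The group `Aut(Z_O/k)` of automorphisms of `Z_O` over `Spec k`. -/
abbrev ConfigAut {k : Subring QBar} {V : Scheme.{0}} (f : V ⟶ specOf k) (O : Set (KPoints f)) :
    Type :=
  Aut (Over.mk (configHom f O))

theorem coe_configClosed {k : Subring QBar} {V : Scheme.{0}} (f : V ⟶ specOf k) [IsSeparated f]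
    (O : Set (KPoints f)) (hO : O.Finite) :
    (configClosed f O : Set V) = ⋃ y ∈ O, Set.range y.1 := by
  apply IsClosed.closure_eq
  refine hO.isClosed_biUnion fun y _ => ?_
  have h1 : IsClosedImmersion (y.1 ≫ f) := by rw [y.2]; infer_instance
  have h2 : IsClosedImmersion y.1 := IsClosedImmersion.of_comp y.1 f
  exact y.1.isClosedEmbedding.isClosed_range

/-! ### Explicit descriptions by finite data -/

/-- An integer polynomial in variables `v₀, v₁, …`, written out as a list of terms: the entry
`(c, [e₀, e₁, …])` stands for `c * v₀ ^ e₀ * v₁ ^ e₁ * ⋯`. -/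
abbrev SparsePoly : Type := List (ℤ × List ℕ)

/-- The value of a polynomial at a list of elements of a commutative ring. -/
def SparsePoly.eval {R : Type} [CommRing R] (P : SparsePoly) (v : List R) : R :=
  (P.map fun t => (t.1 : R) * (List.zipWith (fun a e => a ^ e) v t.2).prod).sum

/-- The polynomial `c₀ + c₁ T + c₂ T ^ 2 + ⋯` with the given list of coefficients. -/
def densePoly (c : List ℤ) : Polynomial ℤ :=
  ∑ i ∈ Finset.range c.length, Polynomial.C (c.getD i 0) * Polynomial.X ^ i

/-- One piece `(h, e, [g₀, g₁, …])` of the gluing data from a chart `i` to a chart `j`: on the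
locus in the chart `i` where `h` is invertible, the coordinates of the chart `j` are
`g₀ / h ^ e, g₁ / h ^ e, …`. -/
abbrev GluePiece : Type := SparsePoly × ℕ × List SparsePoly

/-- The finite data of an explicit description of a finitely generated subring `k` of `ℚ̄` and of
a scheme of finite type over `k`. -/
structure Description : Type where
  /-- the coefficients of an irreducible integer polynomial, with a root `θ` -/
  minPoly : List ℤ
  /-- the generators of `k`; the entry `(g, d)` stands for `g(θ) / d` -/
  gens : List (List ℤ × ℕ)
  /-- the affine charts; the entry `(n, [F₁, F₂, …])` stands for the closed subscheme of affine
  `n`-space over `k` with the equations `F₁ = F₂ = ⋯ = 0` -/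
  charts : List (ℕ × List SparsePoly)
  /-- the gluing data: the entry number `j` of the entry number `i` of this list describes the
  intersection of the charts `i` and `j`, and the change of coordinates on it -/
  glue : List (List (List GluePiece))

/-- A description is a tuple of lists of numbers. -/
def Description.equivProd : Description ≃
    List ℤ × List (List ℤ × ℕ) × List (ℕ × List SparsePoly) × List (List (List GluePiece)) where
  toFun D := (D.minPoly, D.gens, D.charts, D.glue)
  invFun t := ⟨t.1, t.2.1, t.2.2.1, t.2.2.2⟩
  left_inv _ := rfl
  right_inv _ := rfl

/-- Algorithms take descriptions as inputs through the standard coding of tuples of lists of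
numbers. -/
instance : Primcodable Description := Primcodable.ofEquiv _ Description.equivProd

namespace Description

/-- The number of charts. -/
abbrev numCharts (D : Description) : ℕ := D.charts.length

/-- The number of coordinates of the chart `i`. -/
abbrev numCoords (D : Description) (i : Fin D.numCharts) : ℕ := (D.charts.get i).1

/-- The equations of the chart `i`. -/
abbrev equations (D : Description) (i : Fin D.numCharts) : List SparsePoly := (D.charts.get i).2

/-- The gluing data from the chart `i` to the chart `j`. -/
abbrev gluePieces (D : Description) (i j : Fin D.numCharts) : List GluePiece :=
  (D.glue.getD i []).getD j []

/-- `D` describes the subring `k` of `ℚ̄` with the generators `a`. -/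
def DescribesRing (D : Description) (k : Subring QBar) (a : Fin D.gens.length → k) : Prop :=
  (∃ θ : QBar, Irreducible (densePoly D.minPoly) ∧ Polynomial.aeval θ (densePoly D.minPoly) = 0 ∧
    ∀ i, 0 < (D.gens.get i).2 ∧
      (a i : QBar) = Polynomial.aeval θ (densePoly (D.gens.get i).1) / ((D.gens.get i).2 : QBar)) ∧
  Subring.closure (Set.range a) = ⊤

/-- A polynomial over `k` in `n` coordinates, from an integer polynomial in the generators `a` of
`k` followed by the coordinates. -/
def toMvPolynomial {k : Subring QBar} {m : ℕ} (a : Fin m → k) (n : ℕ) (P : SparsePoly) :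
    MvPolynomial (Fin n) k :=
  P.eval (List.ofFn (fun i => MvPolynomial.C (a i)) ++ List.ofFn MvPolynomial.X)

/-- The structure homomorphism from `k` to the ring of functions on an open subset of a
`k`-scheme. -/
def structureHom {k : Subring QBar} {V : Scheme.{0}} (f : V ⟶ specOf k) (U : V.Opens) :
    k →+* Γ(V, U) :=
  ((Scheme.ΓSpecIso (CommRingCat.of k)).inv ≫ f.appLE ⊤ U le_top).hom

/-- The homomorphism `k[x₁, …, xₙ] → Γ(V, U)` of `k`-algebras that sends the variables to given
functions on `U`. -/
def coordHom {k : Subring QBar} {V : Scheme.{0}} (f : V ⟶ specOf k) (U : V.Opens) {n : ℕ}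
    (x : Fin n → Γ(V, U)) : MvPolynomial (Fin n) k →+* Γ(V, U) :=
  MvPolynomial.eval₂Hom (structureHom f U) x

/-- `D` describes the subring `k` of `ℚ̄` and the `k`-scheme `f : V ⟶ Spec k`: for some
generators `a` of `k` and some affine open covering `U` of `V` with coordinates `x`, the ring
`Γ(V, U i)` is the quotient of the polynomial ring over `k` by the ideal that the listed equations
generate, the intersection of `U i` and `U j` is the union of the listed basic open subsets of
`U i`, and on each of these the coordinates of `U j` are the listed fractions in those of `U i`. -/
def Describes (D : Description) {k : Subring QBar} {V : Scheme.{0}} (f : V ⟶ specOf k) : Prop :=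
  ∃ (a : Fin D.gens.length → k) (U : Fin D.numCharts → V.Opens)
    (x : ∀ i, Fin (D.numCoords i) → Γ(V, U i)),
    D.DescribesRing k a ∧
    (∀ i, IsAffineOpen (U i)) ∧
    (⨆ i, U i) = ⊤ ∧
    (∀ i, Function.Surjective (coordHom f (U i) (x i))) ∧
    (∀ i, RingHom.ker (coordHom f (U i) (x i)) =
      Ideal.span {F | ∃ P ∈ D.equations i, F = toMvPolynomial a (D.numCoords i) P}) ∧
    -- the value in `Γ(V, U i)` of an integer polynomial in `a` and the coordinates `x i`
    let val : ∀ i, SparsePoly → Γ(V, U i) := fun i P =>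
      coordHom f (U i) (x i) (toMvPolynomial a (D.numCoords i) P)
    ∀ i j,
      U i ⊓ U j = (⨆ t ∈ D.gluePieces i j, V.basicOpen (val i t.1)) ∧
      ∀ t ∈ D.gluePieces i j, ∃ hj : V.basicOpen (val i t.1) ≤ U j,
        ∀ l : Fin (D.numCoords j),
          V.presheaf.map (homOfLE (V.basicOpen_le (val i t.1))).op (val i t.1) ^ t.2.1 *
              V.presheaf.map (homOfLE hj).op (x j l) =
            V.presheaf.map (homOfLE (V.basicOpen_le (val i t.1))).op (val i (t.2.2.getD l []))

end Description

end

/-! The group `Aut(Z_O/k)` acts on the points of `Z_O` with values in any finite local `k`-algebra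
`R`. These points embed into `V(R)`, whose size is bounded by `|R|` and the numbers of coordinates
of the charts (`card_points_le`), independently of `O`. So it suffices to find two such algebras,
depending only on `k`, on whose points the group acts jointly faithfully.

Let `p` be a prime number that is not invertible in `k`, let `W` be the localization of `k` at a
maximal ideal containing `p`, and put `R = (W/p)[ε]`. Suppose that `σ` fixes all `R`-points and `σ ^
r = 1` with `r` prime to `p`. Let `y` be a section, restricted to `Spec W`. Fixing `y` modulo `p`
starts an induction: if `σ` moves `y` by `p ^ (s + 1) δ`, then `y + δ ε` is an `R`-point, so `δ` is
invariant under `σ` modulo `p`. The displacements along the orbit add up to zero, hence `r δ ≡ 0`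
and `δ ≡ 0` modulo `p`, and the congruence improves by one power of `p`. By Krull's intersection
theorem `σ` fixes `y` (`comp_eq_of_tangent_fixed`, `exists_detecting_algebra`). As `Z_O` is reduced
and covered by sections, `σ = 1` (`eq_of_comp_sections_eq`).

Thus the kernel of the action for `p` has no elements of prime order other than `p`. The group is
finite, since it permutes the finitely many sections of `Z_O` faithfully; hence for two primes the
kernels meet trivially (`card_group_le`).

The constant is computable: `k` lies in a number field whose degree `d` is bounded by the
description, so `|R| ≤ p ^ (2 d)`; and a prime that does not divide a common multiple `N` of the
denominators and the leading coefficient is not invertible in `k`. Prime factors of `N + 1` and `N p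
+ 1` serve as the two primes. -/

open CategoryTheory AlgebraicGeometry

noncomputable section

/-! ### Automorphisms that act trivially on tangent vectors -/

section Tangent

open TrivSqZeroExt

variable {A W : Type} [CommRing A] [CommRing W]

/-- Two ring homomorphisms `y, y'` to `W` whose difference is `p ^ (s + 1)` times `δ` give the
tangent vector `y + δ ε` modulo `p`. -/
def tangentHom {p : W} (hp : p ∈ nonZeroDivisors W) {s : ℕ} (y y' : A →+* W) (δ : A → W)
    (h : ∀ a, y' a - y a = p ^ (s + 1) * δ a) : A →+* DualNumber (W ⧸ Ideal.span {p}) where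
  toFun a := inl (Ideal.Quotient.mk _ (y a)) + inr (Ideal.Quotient.mk _ (δ a))
  map_one' := by
    have h1 : δ 1 = 0 := by
      have := h 1
      rw [map_one, map_one, sub_self] at this
      exact (mem_nonZeroDivisors_iff.1 (pow_mem hp (s + 1))).1 _ this.symm
    rw [h1, map_one, map_one, map_zero]
    simp
  map_zero' := by
    have h1 : δ 0 = 0 := by
      have := h 0
      rw [map_zero, map_zero, sub_self] at this
      exact (mem_nonZeroDivisors_iff.1 (pow_mem hp (s + 1))).1 _ this.symm
    rw [h1, map_zero, map_zero]
    simp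
  map_add' a b := by
    have h1 : δ (a + b) = δ a + δ b := by
      refine (mul_cancel_left_mem_nonZeroDivisors (pow_mem hp (s + 1))).1 ?_
      rw [mul_add, ← h, ← h, ← h, map_add, map_add]
      ring
    ext <;> simp [h1]
  map_mul' a b := by
    -- The quadratic error term vanishes modulo `p` because the exponent `s + 1` is positive.
    have h1 : δ (a * b) = y a * δ b + y b * δ a + p * (p ^ s * δ a * δ b) := by
      refine (mul_cancel_left_mem_nonZeroDivisors (pow_mem hp (s + 1))).1 ?_
      have ha := h a
      have hb := h b
      have hab := h (a * b)
      rw [← hab, map_mul, map_mul, eq_add_of_sub_eq ha, eq_add_of_sub_eq hb]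
      ring
    have h2 : Ideal.Quotient.mk (Ideal.span {p}) (δ (a * b)) =
        Ideal.Quotient.mk _ (y a * δ b + y b * δ a) := by
      rw [h1, Ideal.Quotient.mk_eq_mk_iff_sub_mem, add_sub_cancel_left]
      exact Ideal.mem_span_singleton.2 ⟨_, rfl⟩
    ext
    · simp
    · simp [h2, mul_comm (Ideal.Quotient.mk (Ideal.span {p}) (δ a))]

theorem tangentHom_apply {p : W} (hp : p ∈ nonZeroDivisors W) {s : ℕ} (y y' : A →+* W)
    (δ : A → W) (h : ∀ a, y' a - y a = p ^ (s + 1) * δ a) (a : A) :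
    tangentHom hp y y' δ h a =
      inl (Ideal.Quotient.mk _ (y a)) + inr (Ideal.Quotient.mk _ (δ a)) := rfl

/-- If an endomorphism `α` of `A` fixes the tangent vectors modulo `p` and has finite order prime
to `p` along a `W`-valued point `y`, then it fixes `y`. -/
theorem comp_eq_of_tangent_fixed {p : W} (hp : p ∈ nonZeroDivisors W)
    (hsep : ∀ w : W, (∀ s : ℕ, p ^ s ∣ w) → w = 0) {r : ℕ}
    (hr : IsUnit (r : W ⧸ Ideal.span {p})) (α : A →+* A) (y : A →+* W)
    (hy : ∀ a, y (α^[r] a) = y a) {k : Type} [CommRing k] (ι : k →+* A)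
    (hι : α.comp ι = ι)
    (ht : ∀ t : A →+* DualNumber (W ⧸ Ideal.span {p}),
      (∀ c, t (ι c) = inl (Ideal.Quotient.mk _ (y (ι c)))) → t.comp α = t) :
    y.comp α = y := by
  have key : ∀ s : ℕ, ∀ a, p ^ (s + 1) ∣ y (α a) - y a := by
    intro s
    induction s with
    | zero =>
      intro a
      -- The zero tangent vector at `y` gives `y ∘ α ≡ y` modulo `p`.
      have h := ht (tangentHom (s := 0) hp y y (fun _ => 0) (by simp))
        (fun c => by simp [tangentHom_apply])
      have h1 := congrArg fst (RingHom.congr_fun h a)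
      simp only [RingHom.comp_apply, tangentHom_apply, fst_add, fst_inl, fst_inr, add_zero] at h1
      rw [Ideal.Quotient.mk_eq_mk_iff_sub_mem, Ideal.mem_span_singleton] at h1
      simpa using h1
    | succ s ih =>
      choose δ hδ using ih
      -- Since `α` is `k`-linear, the tangent vector `y + δ ε` is a point over `k`, as `ht`
      -- requires.
      have hδι : ∀ c, δ (ι c) = 0 := by
        intro c
        have h := hδ (ι c)
        rw [← RingHom.comp_apply α ι, hι, sub_self] at h
        exact (mem_nonZeroDivisors_iff.1 (pow_mem hp (s + 1))).1 _ h.symm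
      have h := ht (tangentHom hp y (y.comp α) δ (by simpa using hδ))
        (fun c => by simp [tangentHom_apply, hδι])
      have h1 : ∀ a, Ideal.Quotient.mk (Ideal.span {p}) (δ (α a)) = Ideal.Quotient.mk _ (δ a) := by
        intro a
        have h1 := congrArg snd (RingHom.congr_fun h a)
        simpa [RingHom.comp_apply, tangentHom_apply] using h1
      have h2 : ∀ j : ℕ, ∀ a, Ideal.Quotient.mk (Ideal.span {p}) (δ (α^[j] a)) =
          Ideal.Quotient.mk _ (δ a) := by
        intro j
        induction j with
        | zero => simp
        | succ j ih => intro a; rw [Function.iterate_succ_apply, ih, h1]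
      intro a
      -- The displacements along the closed orbit telescope. Modulo `p` all `r` summands equal `δ
      -- a`, so `r δ a ≡ 0`.
      have h3 : ∑ j ∈ Finset.range r, δ (α^[j] a) = 0 := by
        have : ∑ j ∈ Finset.range r, (y (α^[j + 1] a) - y (α^[j] a)) = 0 := by
          rw [Finset.sum_range_sub (fun j => y (α^[j] a)), hy]
          simp
        simp only [Function.iterate_succ_apply', hδ, ← Finset.mul_sum] at this
        exact (mem_nonZeroDivisors_iff.1 (pow_mem hp (s + 1))).1 _ this
      have h4 : (r : W ⧸ Ideal.span {p}) * Ideal.Quotient.mk _ (δ a) = 0 := by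
        have := congrArg (Ideal.Quotient.mk (Ideal.span {p})) h3
        rw [map_sum, map_zero] at this
        simpa [h2] using this
      rw [hr.mul_right_eq_zero, Ideal.Quotient.eq_zero_iff_mem, Ideal.mem_span_singleton] at h4
      obtain ⟨w, hw⟩ := h4
      exact ⟨w, by rw [hδ, hw]; ring⟩
  ext a
  refine sub_eq_zero.1 (hsep _ fun s => ?_)
  exact (pow_dvd_pow p (Nat.le_succ s)).trans (key s a)

end Tangent

/-! ### Reduction of torsion-free rings modulo a prime number -/

theorem finite_of_rank_le {F M : Type} [Field F] [Finite F] [AddCommGroup M] [Module F M] {d : ℕ}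
    (h : Module.rank F M ≤ d) : Finite M ∧ Nat.card M ≤ Nat.card F ^ d := by
  have hM : Module.Finite F M := Module.rank_lt_aleph0_iff.1 (h.trans_lt Cardinal.natCast_lt_aleph0)
  refine ⟨Module.finite_of_finite F, ?_⟩
  rw [Module.natCard_eq_pow_finrank (K := F)]
  exact Nat.pow_le_pow_right Nat.card_pos (Module.finrank_le_of_rank_le h)

/-- A ring of rank at most `d` without `p`-torsion has at most `p ^ d` elements modulo `p`. -/
theorem finite_quotient_prime {R : Type} [CommRing R] [IsDomain R] [CharZero R] {d : ℕ}
    (hd : ∀ b : Fin (d + 1) → R, ¬ LinearIndependent ℤ b) {p : ℕ} (hp : p.Prime) :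
    Finite (R ⧸ Ideal.span {(p : R)}) ∧ Nat.card (R ⧸ Ideal.span {(p : R)}) ≤ p ^ d := by
  have : Fact p.Prime := ⟨hp⟩
  set Q := R ⧸ Ideal.span {(p : R)}
  let _ : Module (ZMod p) Q := AddCommGroup.zmodModule fun x => by
    obtain ⟨x, rfl⟩ := Ideal.Quotient.mk_surjective x
    rw [nsmul_eq_mul, ← map_natCast (Ideal.Quotient.mk (Ideal.span {(p : R)})), ← map_mul,
      Ideal.Quotient.eq_zero_iff_mem]
    exact Ideal.mul_mem_right _ _ (Ideal.mem_span_singleton_self _)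
  have hpR : (p : R) ≠ 0 := Nat.cast_ne_zero.2 hp.ne_zero
  -- Dividing an integral relation by the gcd of its coefficients, which torsion-freeness allows,
  -- leaves one that is nontrivial modulo `p`.
  have hrel : ∀ b : Fin (d + 1) → R, ∃ c : Fin (d + 1) → ℤ, ∑ i, c i • b i = 0 ∧
      ∃ i, ¬ (p : ℤ) ∣ c i := by
    intro b
    have h := hd b
    rw [Fintype.linearIndependent_iff] at h
    push Not at h
    obtain ⟨c, hc, i, hi⟩ := h
    obtain ⟨g, hg⟩ : ∃ g : ℤ, g = Finset.univ.gcd c := ⟨_, rfl⟩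
    obtain ⟨c', hc', hg'⟩ := Finset.extract_gcd c (s := Finset.univ) ⟨i, Finset.mem_univ i⟩
    rw [← hg] at hc'
    have hg0 : g ≠ 0 := by
      rintro rfl
      exact hi (by rw [hc' i (Finset.mem_univ i), zero_mul])
    refine ⟨c', ?_, ?_⟩
    · have h1 : g • ∑ i, c' i • b i = 0 := by
        rw [Finset.smul_sum, ← hc]
        exact Finset.sum_congr rfl fun i hi => by rw [hc' i hi, mul_smul]
      exact (smul_eq_zero.1 h1).resolve_left hg0
    · by_contra hcon
      push Not at hcon
      have : (p : ℤ) ∣ 1 := hg' ▸ Finset.dvd_gcd fun i _ => hcon i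
      exact hp.one_lt.ne' (by exact_mod_cast Int.eq_one_of_dvd_one (by positivity) this)
  have hlin : ∀ b : Fin (d + 1) → Q, ¬ LinearIndependent (ZMod p) b := by
    intro b hb
    choose b' hb' using fun i => Ideal.Quotient.mk_surjective (b i)
    obtain ⟨c, hc, i, hi⟩ := hrel b'
    rw [Fintype.linearIndependent_iff] at hb
    refine hi ((ZMod.intCast_zmod_eq_zero_iff_dvd _ _).1 (hb (fun i => (c i : ZMod p)) ?_ i))
    have h1 := congrArg (Ideal.Quotient.mk (Ideal.span {(p : R)})) hc
    rw [map_sum, map_zero] at h1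
    rw [← h1]
    refine Finset.sum_congr rfl fun i _ => ?_
    rw [map_zsmul, hb', Int.cast_smul_eq_zsmul]
  have hrank : Module.rank (ZMod p) Q ≤ d := by
    refine rank_le fun s hs => ?_
    by_contra hcon
    push Not at hcon
    obtain ⟨t, hts, htc⟩ := Finset.exists_subset_card_eq (Nat.succ_le_of_lt hcon)
    have h2 : LinearIndependent (ZMod p) (fun i : t => (i : Q)) :=
      hs.comp (fun i : t => (⟨i, hts i.2⟩ : s)) fun i j hij =>
        Subtype.ext (congrArg (fun z : s => (z : Q)) hij)
    exact hlin _ (h2.comp _ (t.equivFin.trans (finCongr htc)).symm.injective)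
  have h := finite_of_rank_le hrank
  rwa [Nat.card_zmod] at h

/-- Modulo a prime number, the localization at a maximal ideal is a quotient of the ring, if the
latter is finite. -/
theorem surjective_quotient_localization {k : Type} [CommRing k] (P : Ideal k) [P.IsPrime] (x : k)
    [Finite (k ⧸ Ideal.span {x})] :
    Function.Surjective ((Ideal.Quotient.mk
      (Ideal.span {algebraMap k (Localization.AtPrime P) x})).comp
        (algebraMap k (Localization.AtPrime P))) := by
  set W := Localization.AtPrime P
  set f := (Ideal.Quotient.mk (Ideal.span {algebraMap k W x})).comp (algebraMap k W)
  have hfin : Finite f.range := by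
    have h : ∀ a ∈ Ideal.span {x}, f a = 0 := by
      intro a ha
      obtain ⟨b, rfl⟩ := Ideal.mem_span_singleton.1 ha
      rw [RingHom.comp_apply, Ideal.Quotient.eq_zero_iff_mem, map_mul]
      exact Ideal.mul_mem_right _ _ (Ideal.mem_span_singleton_self _)
    refine Set.Finite.subset (Set.finite_range (Ideal.Quotient.lift _ f h)) ?_
    rintro _ ⟨a, rfl⟩
    exact ⟨Ideal.Quotient.mk _ a, by simp⟩
  intro w
  obtain ⟨w, rfl⟩ := Ideal.Quotient.mk_surjective w
  obtain ⟨a, s, rfl⟩ := IsLocalization.exists_mk'_eq P.primeCompl w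
  have hs : IsUnit (f s) := (IsLocalization.map_units W s).map (Ideal.Quotient.mk _)
  -- Multiplication by the unit `f s` is injective on the finite ring `f.range`, hence surjective,
  -- so the inverse of the denominator already comes from `k`.
  have hinv : ∃ b ∈ f.range, b * f s = 1 := by
    have hinj : Function.Injective (fun b : f.range => b * ⟨f s, s, rfl⟩) := by
      intro b c hbc
      exact Subtype.ext (hs.mul_left_injective (congrArg Subtype.val hbc))
    obtain ⟨b, hb⟩ := Finite.surjective_of_injective hinj 1
    exact ⟨b, b.2, congrArg Subtype.val hb⟩
  obtain ⟨_, ⟨b, rfl⟩, hb⟩ := hinv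
  refine ⟨a * b, hs.mul_left_injective ?_⟩
  have h1 : Ideal.Quotient.mk (Ideal.span {algebraMap k W x}) (IsLocalization.mk' W a s) * f s =
      f a := by
    rw [RingHom.comp_apply, ← map_mul, IsLocalization.mk'_spec]; rfl
  change f (a * b) * f s = _ * f s
  rw [h1, map_mul, mul_assoc, hb, mul_one]

/-! ### Reduced closed subschemes -/

section Reduced

open Scheme.IdealSheafData

/-- The zero ideal of a reduced scheme is the vanishing ideal of the whole space, and vanishing
ideals push forward to vanishing ideals. Hence a map from a reduced scheme factors through a reduced
closed subscheme as soon as it does so on points. -/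
theorem vanishingIdeal_le_ker {X Y : Scheme.{0}} [IsReduced X] (f : X ⟶ Y)
    (Z : TopologicalSpace.Closeds Y) (h : Set.range f ⊆ Z) : vanishingIdeal Z ≤ f.ker := by
  rw [← map_bot, ← Scheme.nilradical_eq_bot, ← vanishingIdeal_top, map_vanishingIdeal]
  refine vanishingIdeal_antimono ?_
  rw [TopologicalSpace.Closeds.closure_le]
  simpa using h

theorem ker_eq_vanishingIdeal {X Y : Scheme.{0}} [IsReduced X] (f : X ⟶ Y) :
    f.ker = vanishingIdeal (.closure (Set.range f)) := by
  rw [← map_bot, ← Scheme.nilradical_eq_bot, ← vanishingIdeal_top, map_vanishingIdeal]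
  simp

instance isReduced_subscheme_vanishingIdeal {X : Scheme.{0}} (Z : TopologicalSpace.Closeds X) :
    IsReduced (vanishingIdeal Z).subscheme := by
  have h : ∀ i, AlgebraicGeometry.IsReduced
      ((vanishingIdeal Z).subschemeCover.openCover.X i) := by
    intro (U : X.affineOpens)
    change AlgebraicGeometry.IsReduced (Spec (.of (Γ(X, U.1) ⧸ (vanishingIdeal Z).ideal U)))
    rw [affine_isReduced_iff]
    refine (Ideal.isRadical_iff_quotient_reduced _).1 ?_
    exact PrimeSpectrum.isRadical_vanishingIdeal _
  exact AlgebraicGeometry.IsReduced.of_openCover _ (vanishingIdeal Z).subschemeCover.openCover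

end Reduced

/-- The group of automorphisms of an object acts on its `T`-valued points. -/
def autPerm {C : Type*} [Category* C] (T X : C) : Aut X →* Equiv.Perm (T ⟶ X) where
  toFun σ :=
    { toFun g := g ≫ σ.hom
      invFun g := g ≫ σ.inv
      left_inv := (show X ≅ X from σ).homToEquiv.left_inv
      right_inv := (show X ≅ X from σ).homToEquiv.right_inv }
  map_one' := by ext g; exact Category.comp_id g
  -- In `Aut` the product `σ * τ` is `τ ≫ σ`, so postcomposition is a left action.
  map_mul' σ τ := by ext g; exact (Category.assoc _ _ _).symm

/-! ### Points of schemes with values in local rings -/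

/-- This replaces the scheme by a stalk, where the tangent vector argument is one about rings. The
point `z` is a separate variable so that a point and its image under an endomorphism fixing `z` use
the same stalk. -/
theorem exists_fromSpecStalk_factor {Z : Scheme.{0}} {R : CommRingCat.{0}} [IsLocalRing R]
    (g : Spec R ⟶ Z) (z : Z) (hz : g (IsLocalRing.closedPoint R) = z) :
    ∃ α : Z.presheaf.stalk z ⟶ R, g = Spec.map α ≫ Z.fromSpecStalk z := by
  subst hz
  exact ⟨_, (Scheme.Spec_stalkClosedPointTo_fromSpecStalk g).symm⟩

instance isLocalRing_dualNumber {R : Type} [CommRing R] [IsLocalRing R] :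
    IsLocalRing (DualNumber R) := by
  refine ⟨fun {a b} h => ?_⟩
  rw [TrivSqZeroExt.isUnit_iff_isUnit_fst, TrivSqZeroExt.isUnit_iff_isUnit_fst]
  refine IsLocalRing.isUnit_or_isUnit_of_add_one ?_
  simpa using congrArg TrivSqZeroExt.fst h

/-- If an endomorphism `f` of a `k`-scheme fixes all points with values in the dual numbers over
`W / p`, and a point `y` with values in the local ring `W` has a finite orbit under `f`, of length
prime to `p`, then `f` fixes `y`. -/
theorem comp_eq_of_dualNumber_points_fixed {k W : Type} [CommRing k] [CommRing W] [Algebra k W]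
    [IsLocalRing W] {p : W} (hp : p ∈ nonZeroDivisors W) (hpu : ¬ IsUnit p)
    (hsep : ∀ w : W, (∀ s : ℕ, p ^ s ∣ w) → w = 0) {r : ℕ}
    (hr : IsUnit (r : W ⧸ Ideal.span {p})) {Z : Scheme.{0}} (h : Z ⟶ Spec (.of k)) (f : Z ⟶ Z)
    (hf : f ≫ h = h)
    (hfix : ∀ g : Spec (.of (DualNumber (W ⧸ Ideal.span {p}))) ⟶ Z,
      g ≫ h = Spec.map (CommRingCat.ofHom (algebraMap k _)) → g ≫ f = g)
    (y : Spec (.of W) ⟶ Z) (hy : y ≫ h = Spec.map (CommRingCat.ofHom (algebraMap k W)))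
    (hyr : (fun g => g ≫ f)^[r] y = y) :
    y ≫ f = y := by
  set T := W ⧸ Ideal.span {p}
  have : Nontrivial T := Ideal.Quotient.nontrivial_iff.2 (by rwa [Ne, Ideal.span_singleton_eq_top])
  have : IsLocalRing T := .of_surjective' (Ideal.Quotient.mk _) Ideal.Quotient.mk_surjective
  let q : W →+* DualNumber T := (TrivSqZeroExt.inlHom T T).comp (Ideal.Quotient.mk _)
  have hq : IsLocalHom (CommRingCat.ofHom q).hom := by
    have := IsLocalHom.of_surjective (Ideal.Quotient.mk (Ideal.span {p}))
      Ideal.Quotient.mk_surjective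
    exact ⟨fun w hw => isUnit_of_map_unit (Ideal.Quotient.mk (Ideal.span {p})) w
      (by simpa [q] using TrivSqZeroExt.isUnit_iff_isUnit_fst.1 hw)⟩
  have hqk : q.comp (algebraMap k W) = algebraMap k (DualNumber T) := rfl
  obtain ⟨z, hz⟩ : ∃ z : Z, y (IsLocalRing.closedPoint W) = z := ⟨_, rfl⟩
  obtain ⟨β, hβ⟩ := exists_fromSpecStalk_factor (R := .of W) y z hz
  -- The reduction of `y` with zero tangent vector is one of the fixed points, and `W → (W/p)[ε]` is
  -- local, so it has the same closed point `z`. Therefore `f` induces an endomorphism of the stalk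
  -- at `z`.
  have hfz : f z = z := by
    have h := hfix (Spec.map (CommRingCat.ofHom q) ≫ y) (by
      rw [Category.assoc, hy, ← Spec.map_comp, ← CommRingCat.ofHom_comp, hqk])
    have h1 : (Spec.map (CommRingCat.ofHom q) ≫ y)
        (IsLocalRing.closedPoint (CommRingCat.of (DualNumber T))) = z :=
      (Scheme.Hom.comp_apply _ _ _).trans
        ((congrArg y (Spec_closedPoint (f := CommRingCat.ofHom q))).trans hz)
    have h2 := congrArg (fun u : Spec (.of (DualNumber T)) ⟶ Z =>
      u (IsLocalRing.closedPoint (CommRingCat.of (DualNumber T)))) h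
    exact (congrArg f h1).symm.trans (((Scheme.Hom.comp_apply _ _ _).symm.trans h2).trans h1)
  obtain ⟨α, hα⟩ := exists_fromSpecStalk_factor (Z.fromSpecStalk z ≫ f) z
    ((Scheme.Hom.comp_apply _ _ _).trans
      ((congrArg f Scheme.fromSpecStalk_closedPoint).trans hfz))
  obtain ⟨κ, hκ⟩ : ∃ κ, Z.fromSpecStalk z ≫ h = Spec.map κ := ⟨_, (Spec.map_preimage _).symm⟩
  have hκα : κ ≫ α = κ := Spec.map_injective (by
    rw [Spec.map_comp, ← hκ, ← reassoc_of% hα, hf])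
  have hκβ : κ ≫ β = CommRingCat.ofHom (algebraMap k W) := Spec.map_injective (by
    rw [Spec.map_comp, ← hκ, ← reassoc_of% hβ, hy])
  have hpow : ∀ (j : ℕ) (γ : Z.presheaf.stalk z ⟶ .of W),
      (fun g => g ≫ f)^[j] (Spec.map γ ≫ Z.fromSpecStalk z) =
        Spec.map (CommRingCat.ofHom (γ.hom.comp (α.hom ^ j))) ≫ Z.fromSpecStalk z := by
    intro j
    induction j with
    | zero => intro γ; rfl
    | succ j ih =>
      intro γ
      rw [Function.iterate_succ_apply, Category.assoc, hα, ← Spec.map_comp_assoc, ih]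
      congr 3
      rw [pow_succ']
      rfl
  have key := comp_eq_of_tangent_fixed hp hsep hr α.hom β.hom (fun a => ?_) κ.hom
    (congrArg CommRingCat.Hom.hom hκα) (fun t ht => ?_)
  · rw [hβ, Category.assoc, hα, ← Spec.map_comp_assoc]
    congr 2
    exact CommRingCat.hom_ext key
  · rw [hβ, hpow, cancel_mono] at hyr
    have h1 := congrArg (fun u => u.hom a) (Spec.map_injective hyr)
    simpa [RingHom.coe_pow] using h1
  · have h1 := hfix (Spec.map (CommRingCat.ofHom t) ≫ Z.fromSpecStalk z) (by
      rw [Category.assoc, hκ, ← Spec.map_comp]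
      congr 1
      refine CommRingCat.hom_ext (RingHom.ext fun c => (ht c).trans ?_)
      exact congrArg (fun u : CommRingCat.of k ⟶ .of W =>
        TrivSqZeroExt.inl (Ideal.Quotient.mk _ (u.hom c))) hκβ)
    rw [Category.assoc, hα, ← Spec.map_comp_assoc, cancel_mono] at h1
    exact congrArg CommRingCat.Hom.hom (Spec.map_injective h1)

theorem isDominant_SpecMap {R S : CommRingCat.{0}} (φ : R ⟶ S)
    (hφ : Function.Injective φ.hom) : IsDominant (Spec.map φ) :=
  ⟨(PrimeSpectrum.denseRange_comap_iff_ker_le_nilRadical φ.hom).2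
    (by rw [(RingHom.injective_iff_ker_eq_bot _).1 hφ]; exact bot_le)⟩

/-- For a prime number `p` that is not a unit of `k`, there is a finite local `k`-algebra `R` such
that an endomorphism which fixes all `R`-valued points fixes all `k`-valued points whose orbits have
a length prime to `p`. -/
theorem exists_detecting_algebra {k : Type} [CommRing k] [IsDomain k] [IsNoetherianRing k]
    [CharZero k] {d : ℕ} (hd : ∀ b : Fin (d + 1) → k, ¬ LinearIndependent ℤ b) {p : ℕ}
    (hp : p.Prime) (hpu : ¬ IsUnit (p : k)) :
    ∃ (R : Type) (_ : CommRing R) (_ : Algebra k R), IsLocalRing R ∧ Finite R ∧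
      Nat.card R ≤ (p ^ d) ^ 2 ∧
      ∀ (Z : Scheme.{0}) (h : Z ⟶ Spec (.of k)) [IsSeparated h] (f : Z ⟶ Z), f ≫ h = h →
        (∀ g : Spec (.of R) ⟶ Z, g ≫ h = Spec.map (CommRingCat.ofHom (algebraMap k R)) →
          g ≫ f = g) →
        ∀ r : ℕ, r.Coprime p → ∀ y : Spec (.of k) ⟶ Z, y ≫ h = 𝟙 _ →
          (fun g => g ≫ f)^[r] y = y → y ≫ f = y := by
  obtain ⟨P, hP, hpP⟩ := Ideal.exists_le_maximal (Ideal.span {(p : k)})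
    (by rwa [Ne, Ideal.span_singleton_eq_top])
  obtain ⟨hfin, hcard⟩ := finite_quotient_prime hd hp
  let W := Localization.AtPrime P
  have hle : P.primeCompl ≤ nonZeroDivisors k := P.primeCompl_le_nonZeroDivisors
  have hinj : Function.Injective (algebraMap k W) := IsLocalization.injective W hle
  have hdom : IsDomain W := IsLocalization.isDomain_localization hle
  let q : W := algebraMap k W p
  let T := W ⧸ Ideal.span {q}
  have hq0 : q ≠ 0 := by
    rw [Ne, map_eq_zero_iff _ hinj]
    exact Nat.cast_ne_zero.2 hp.ne_zero
  have hqu : ¬ IsUnit q := by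
    rw [IsLocalization.AtPrime.isUnit_to_map_iff W P, Ideal.mem_primeCompl_iff, not_not]
    exact hpP (Ideal.mem_span_singleton_self _)
  have hqt : Ideal.span {q} ≠ ⊤ := by rwa [Ne, Ideal.span_singleton_eq_top]
  have : Nontrivial T := Ideal.Quotient.nontrivial_iff.2 hqt
  have : IsLocalRing T := .of_surjective' (Ideal.Quotient.mk _) Ideal.Quotient.mk_surjective
  have hsurj := surjective_quotient_localization P (p : k)
  have hsurj' : ∃ u : (k ⧸ Ideal.span {(p : k)}) → T, Function.Surjective u := by
    refine ⟨Ideal.Quotient.lift _ ((Ideal.Quotient.mk (Ideal.span {q})).comp (algebraMap k W))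
      fun a ha => ?_, Ideal.Quotient.lift_surjective_of_surjective _ _ hsurj⟩
    obtain ⟨b, rfl⟩ := Ideal.mem_span_singleton.1 ha
    rw [RingHom.comp_apply, Ideal.Quotient.eq_zero_iff_mem, map_mul]
    exact Ideal.mul_mem_right _ _ (Ideal.mem_span_singleton_self _)
  obtain ⟨u, hu⟩ := hsurj'
  have hT : Finite T := Finite.of_surjective u hu
  have hTcard : Nat.card T ≤ p ^ d := (Nat.card_le_card_of_surjective u hu).trans hcard
  -- The detecting algebra is `(W/p)[ε]`, which is `T × T` as a set; this explains the square in the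
  -- bound.
  refine ⟨DualNumber T, inferInstance, inferInstance, inferInstance,
    inferInstanceAs (Finite (T × T)), ?_, ?_⟩
  · rw [sq]
    exact (Nat.card_prod T T).le.trans (Nat.mul_le_mul hTcard hTcard)
  intro Z h _ f hf hfix r hr y hy hyr
  have hru : IsUnit (r : T) := by
    obtain ⟨a, b, hab⟩ := Nat.isCoprime_iff_coprime.2 hr
    have h0 : (p : T) = 0 := by
      rw [← map_natCast (Ideal.Quotient.mk (Ideal.span {q})), Ideal.Quotient.eq_zero_iff_mem,
        ← map_natCast (algebraMap k W)]
      exact Ideal.mem_span_singleton_self _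
    have h1 := congrArg (Int.castRingHom T) hab
    rw [map_add, map_mul, map_mul, map_natCast, map_natCast, map_one, h0, mul_zero, add_zero] at h1
    exact IsUnit.of_mul_eq_one_right _ h1
  have key := comp_eq_of_dualNumber_points_fixed (p := q) (mem_nonZeroDivisors_of_ne_zero hq0) hqu
    (fun w hw => ?_) hru h f hf hfix (Spec.map (CommRingCat.ofHom (algebraMap k W)) ≫ y)
    (by rw [Category.assoc, hy, Category.comp_id]) ?_
  -- A section is determined by its restriction to `Spec W`, because this is dominant over the
  -- reduced scheme `Spec k` and `Z` is separated.
  · have := isDominant_SpecMap (CommRingCat.ofHom (algebraMap k W)) hinj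
    refine ext_of_isDominant_of_isSeparated h ?_ (Spec.map (CommRingCat.ofHom (algebraMap k W))) ?_
    · rw [Category.assoc, hf]
    · rwa [← Category.assoc]
  -- Krull's intersection theorem in the Noetherian domain `W`.
  · have h1 := Ideal.iInf_pow_eq_bot_of_isDomain _ hqt
    rw [← Ideal.mem_bot, ← h1, Ideal.mem_iInf]
    intro s
    rw [Ideal.span_singleton_pow, Ideal.mem_span_singleton]
    exact hw s
  · conv_rhs => rw [← hyr]
    refine Function.Semiconj.iterate_right (f := fun g => Spec.map (CommRingCat.ofHom
      (algebraMap k W)) ≫ g) (fun g => ?_) r y |>.symm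
    exact (Category.assoc _ _ _).symm

/-! ### Counting points with values in a finite local ring -/

theorem eq_of_appLE_eq {V : Scheme.{0}} {R : CommRingCat.{0}} {g g' : Spec R ⟶ V} {U : V.Opens}
    (hU : IsAffineOpen U) (hg : ⊤ ≤ g ⁻¹ᵁ U) (hg' : ⊤ ≤ g' ⁻¹ᵁ U)
    (h : g.appLE U ⊤ hg = g'.appLE U ⊤ hg') : g = g' := by
  have : IsIso (isAffineOpen_top (Spec R)).fromSpec := by
    rw [IsAffineOpen.fromSpec_top]; infer_instance
  rw [← cancel_epi (isAffineOpen_top (Spec R)).fromSpec]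
  rw [← hU.SpecMap_appLE_fromSpec g (isAffineOpen_top _) hg, h, hU.SpecMap_appLE_fromSpec]

open Description in
/-- A scheme with finitely many affine charts has at most as many points with values in a finite
local ring as the charts have systems of coordinates. -/
theorem card_points_le {k : Subring QBar} {V : Scheme.{0}} (f : V ⟶ specOf k) {n : ℕ}
    (m : Fin n → ℕ) (U : Fin n → V.Opens) (hU : ∀ i, IsAffineOpen (U i)) (hcov : ⨆ i, U i = ⊤)
    (x : ∀ i, Fin (m i) → Γ(V, U i)) (hx : ∀ i, Function.Surjective (coordHom f (U i) (x i)))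
    (R : Type) [CommRing R] [IsLocalRing R] [Finite R] (t : Spec (.of R) ⟶ specOf k) :
    Finite {g : Spec (.of R) ⟶ V // g ≫ f = t} ∧
      Nat.card {g : Spec (.of R) ⟶ V // g ≫ f = t} ≤ ∑ i, Nat.card R ^ m i := by
  -- As `R` is local, a chart that contains the image of the closed point contains the whole image.
  have hchart : ∀ g : Spec (.of R) ⟶ V, ∃ i, ⊤ ≤ g ⁻¹ᵁ U i := by
    intro g
    have h : g (IsLocalRing.closedPoint (CommRingCat.of R)) ∈ ⨆ i, U i := by rw [hcov]; trivial
    obtain ⟨i, hi⟩ := TopologicalSpace.Opens.mem_iSup.1 h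
    exact ⟨i, (Scheme.preimage_eq_top_of_closedPoint_mem g hi).ge⟩
  choose c hc using hchart
  let F : {g : Spec (.of R) ⟶ V // g ≫ f = t} → Σ i, (Fin (m i) → R) := fun g =>
    ⟨c g.1, fun l => (Scheme.ΓSpecIso (.of R)).hom (g.1.appLE (U (c g.1)) ⊤ (hc g.1) (x _ l))⟩
  have hF : Function.Injective F := by
    have aux : ∀ (i : Fin n) (g g' : Spec (.of R) ⟶ V) (hg : ⊤ ≤ g ⁻¹ᵁ U i)
        (hg' : ⊤ ≤ g' ⁻¹ᵁ U i), g ≫ f = g' ≫ f →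
        (fun l => (Scheme.ΓSpecIso (.of R)).hom (g.appLE (U i) ⊤ hg (x i l))) =
          (fun l => (Scheme.ΓSpecIso (.of R)).hom (g'.appLE (U i) ⊤ hg' (x i l))) → g = g' := by
      intro i g g' hg hg' hgf h
      refine eq_of_appLE_eq (hU i) hg hg' (CommRingCat.hom_ext ?_)
      rw [← RingHom.cancel_right (hx i)]
      refine MvPolynomial.ringHom_ext (fun a => ?_) fun l => ?_
      · have e : f.appLE ⊤ (U i) le_top ≫ g.appLE (U i) ⊤ hg =
            f.appLE ⊤ (U i) le_top ≫ g'.appLE (U i) ⊤ hg' := by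
          have congr_appLE : ∀ a b : Spec (.of R) ⟶ specOf k, a = b → ∀ ea eb,
              a.appLE ⊤ ⊤ ea = b.appLE ⊤ ⊤ eb := by
            rintro a _ rfl _ _
            rfl
          exact (Scheme.Hom.appLE_comp_appLE g f ⊤ (U i) ⊤ le_top hg).trans
            ((congr_appLE _ _ hgf _ _).trans
              (Scheme.Hom.appLE_comp_appLE g' f ⊤ (U i) ⊤ le_top hg').symm)
        have h1 := congrArg (fun u => u ((Scheme.ΓSpecIso (CommRingCat.of k)).inv a)) e
        simpa [coordHom, structureHom] using h1
      · have h1 := (Scheme.ΓSpecIso (.of R)).commRingCatIsoToRingEquiv.injective (congrFun h l)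
        simpa [coordHom] using h1
    rintro ⟨g, hg⟩ ⟨g', hg'⟩ h
    refine Subtype.ext ?_
    -- The chart index is generalized so that the equality of indices can be substituted in the
    -- dependent pair.
    have haux : ∀ (i : Fin n) (hg'' : ⊤ ≤ g' ⁻¹ᵁ U i), F ⟨g, hg⟩ = ⟨i, fun l =>
        (Scheme.ΓSpecIso (.of R)).hom (g'.appLE (U i) ⊤ hg'' (x i l))⟩ → g = g' := by
      intro i hg'' h
      obtain rfl : c g = i := congrArg Sigma.fst h
      exact aux (c g) g g' (hc g) hg'' (hg.trans hg'.symm) (eq_of_heq (Sigma.mk.inj h).2)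
    exact haux (c g') (hc g') h
  refine ⟨Finite.of_injective F hF, (Nat.card_le_card_of_injective F hF).trans ?_⟩
  rw [Nat.card_sigma]
  simp [Nat.card_fun]

/-! ### Groups acting on two finite sets -/

theorem card_perm_le {X : Type*} [Finite X] {M : ℕ} (hM : Nat.card X ≤ M) :
    Nat.card (Equiv.Perm X) ≤ M ^ M := by
  calc Nat.card (Equiv.Perm X) ≤ Nat.card (X → X) :=
        Nat.card_le_card_of_injective _ DFunLike.coe_injective
    _ = Nat.card X ^ Nat.card X := Nat.card_fun
    _ ≤ M ^ M := by
      rcases Nat.eq_zero_or_pos (Nat.card X) with h | h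
      · rw [h, pow_zero]
        rcases Nat.eq_zero_or_pos M with rfl | h'
        · simp
        · exact Nat.one_le_pow _ _ h'
      · exact (Nat.pow_le_pow_left hM _).trans (Nat.pow_le_pow_right (h.trans_le hM) hM)

/-- If a finite group acts on two sets such that the kernels of the two actions have no elements of
prime order, except for one prime number for each action, then it is a group of permutations of the
two sets. -/
theorem card_group_le {G X Y : Type*} [Group G] [Finite G] [Finite X] [Finite Y]
    (φ : G →* Equiv.Perm X) (ψ : G →* Equiv.Perm Y) {p q : ℕ} (hp : p.Prime) (hq : q.Prime)
    (hpq : p ≠ q) (hφ : ∀ g r, r.Coprime p → g ^ r = 1 → φ g = 1 → g = 1)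
    (hψ : ∀ g r, r.Coprime q → g ^ r = 1 → ψ g = 1 → g = 1) {M : ℕ} (hX : Nat.card X ≤ M)
    (hY : Nat.card Y ≤ M) : Nat.card G ≤ M ^ M * M ^ M := by
  have hinj : Function.Injective (φ.prod ψ) := by
    rw [injective_iff_map_eq_one]
    intro g hg
    rw [MonoidHom.prod_apply, Prod.mk_eq_one] at hg
    by_contra hne
    have hord : orderOf g ≠ 1 := by rwa [Ne, orderOf_eq_one_iff]
    -- A nontrivial element of both kernels has a power `g ^ m` of prime order `r`. This `r` differs
    -- from `p` or from `q`, so one of the two hypotheses excludes it.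
    obtain ⟨r, hr, m, hm⟩ := Nat.exists_prime_and_dvd hord
    have hpow : (g ^ m) ^ r = 1 := by rw [← pow_mul, mul_comm, ← hm, pow_orderOf_eq_one]
    have hgm : g ^ m ≠ 1 := by
      intro h
      have h0 : 0 < m := Nat.pos_of_ne_zero fun h0 => (orderOf_pos g).ne' (by rw [hm, h0, mul_zero])
      have h1 := Nat.le_of_dvd h0 (orderOf_dvd_of_pow_eq_one h)
      rw [hm] at h1
      exact absurd h1 (not_le.2 (lt_mul_of_one_lt_left h0 hr.one_lt))
    by_cases hrp : r = p
    · refine hgm (hψ _ r ((Nat.coprime_primes hr hq).2 (hrp ▸ hpq)) hpow ?_)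
      rw [map_pow, hg.2, one_pow]
    · refine hgm (hφ _ r ((Nat.coprime_primes hr hp).2 hrp) hpow ?_)
      rw [map_pow, hg.1, one_pow]
  calc Nat.card G ≤ Nat.card (Equiv.Perm X × Equiv.Perm Y) := Nat.card_le_card_of_injective _ hinj
    _ = Nat.card (Equiv.Perm X) * Nat.card (Equiv.Perm Y) := Nat.card_prod _ _
    _ ≤ _ := Nat.mul_le_mul (card_perm_le hX) (card_perm_le hY)

/-! ### Schemes covered by sections -/

/-- Two sections are equal if one meets the other in its generic point. -/
theorem section_eq_of_genericPoint_mem {S Z : Scheme.{0}} [IsIntegral S] (h : Z ⟶ S)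
    [IsSeparated h] {s l : S ⟶ Z} (hs : s ≫ h = 𝟙 S) (hl : l ≫ h = 𝟙 S)
    (hη : s (genericPoint S) ∈ Set.range l) : s = l := by
  have h1 : IsClosedImmersion (l ≫ h) := by rw [hl]; infer_instance
  have h2 : IsClosedImmersion l := IsClosedImmersion.of_comp l h
  have hcl : IsClosed (Set.range l) := l.isClosedEmbedding.isClosed_range
  have hrange : Set.range s ⊆ Set.range l := by
    rintro _ ⟨x, rfl⟩
    have hx : x ∈ closure {genericPoint S} := by
      rw [genericPoint_closure]; trivial
    have h3 := image_closure_subset_closure_image s.continuous ⟨x, hx, rfl⟩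
    rw [Set.image_singleton] at h3
    exact (hcl.closure_subset_iff.2 (Set.singleton_subset_iff.2 hη)) h3
  -- Since `S` is reduced, `s` factors through the closed immersion `l`; the factor is the identity
  -- because both are sections.
  have hker : l.ker ≤ s.ker := by
    rw [ker_eq_vanishingIdeal l]
    exact vanishingIdeal_le_ker s _ (hrange.trans subset_closure)
  have hfac := IsClosedImmersion.lift_fac l s hker
  have hone : IsClosedImmersion.lift l s hker = 𝟙 S := by
    have h4 := congrArg (· ≫ h) hfac
    simp only [Category.assoc, hl, hs, Category.comp_id] at h4
    exact h4
  rw [← hfac, hone, Category.id_comp]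

/-- The image of the generic point under `s` lies on some `l i`. So a scheme covered by finitely
many sections has no others. -/
theorem exists_section_eq {S Z : Scheme.{0}} [IsIntegral S] (h : Z ⟶ S) [IsSeparated h]
    {ι : Type} (l : ι → (S ⟶ Z)) (hl : ∀ i, l i ≫ h = 𝟙 S) (hcov : ∀ z : Z, ∃ i x, l i x = z)
    {s : S ⟶ Z} (hs : s ≫ h = 𝟙 S) : ∃ i, s = l i := by
  obtain ⟨i, x, hx⟩ := hcov (s (genericPoint S))
  exact ⟨i, section_eq_of_genericPoint_mem h hs (hl i) ⟨x, hx⟩⟩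

/-- The sections together form a surjective map from a coproduct of copies of `S`, and morphisms
over `S` from a reduced scheme to a separated one are determined on a dominant map. -/
theorem eq_of_comp_sections_eq {S Z : Scheme.{0}} (h : Z ⟶ S) [IsSeparated h]
    {ι : Type} (l : ι → (S ⟶ Z)) (hcov : ∀ z : Z, ∃ i x, l i x = z)
    [IsReduced Z] {f g : Z ⟶ Z} (hfg : f ≫ h = g ≫ h)
    (heq : ∀ i, l i ≫ f = l i ≫ g) : f = g := by
  have : IsDominant (Limits.Sigma.desc l) := by
    refine ⟨Function.Surjective.denseRange fun z => ?_⟩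
    obtain ⟨i, x, rfl⟩ := hcov z
    refine ⟨Limits.Sigma.ι (fun _ => S) i x, ?_⟩
    rw [← Scheme.Hom.comp_apply, Limits.Sigma.ι_desc]
  refine ext_of_isDominant_of_isSeparated h hfg (Limits.Sigma.desc l) ?_
  ext i
  simpa using heq i

/-- The group acts faithfully on the finite set of sections. The resulting bound depends on `ι`, but
finiteness is needed to speak of elements of prime order in `card_group_le`. -/
theorem finite_aut_of_sections {S Z : Scheme.{0}} [IsIntegral S] (h : Z ⟶ S) [IsSeparated h]
    {ι : Type} (l : ι → (S ⟶ Z)) (hl : ∀ i, l i ≫ h = 𝟙 S) (hcov : ∀ z : Z, ∃ i x, l i x = z)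
    [Finite ι] [IsReduced Z] : Finite (Aut (Over.mk h)) := by
  let T : Over S := Over.mk (𝟙 S)
  have hfin : Finite (T ⟶ Over.mk h) := by
    have hs : ∀ g : T ⟶ Over.mk h, ∃ i, g.left = l i := fun g =>
      exists_section_eq h l hl hcov (Over.w g)
    choose c hc using hs
    refine Finite.of_injective c fun g g' hgg => Over.OverMorphism.ext ?_
    rw [hc, hc, hgg]
  refine Finite.of_injective (autPerm T (Over.mk h)) fun σ τ hστ => ?_
  refine Iso.ext (Over.OverMorphism.ext ?_)
  refine eq_of_comp_sections_eq h l hcov ((Over.w (Iso.hom σ)).trans (Over.w (Iso.hom τ)).symm)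
    fun i => ?_
  have h1 := congrArg (fun e => (e (Over.homMk (l i) (hl i))).left) hστ
  exact h1

/-- Translates finite order in the group into the orbit condition of `exists_detecting_algebra`. -/
theorem iterate_comp_hom_left {S : Scheme.{0}} {T X : Over S} (σ : Aut X) {r : ℕ} (hσ : σ ^ r = 1)
    (y : T ⟶ X) : (fun g => g ≫ (Iso.hom σ).left)^[r] y.left = y.left := by
  have h1 : (fun g => g ≫ Iso.hom σ)^[r] y = y := by
    change (autPerm T X σ)^[r] y = y
    rw [Equiv.Perm.iterate_eq_pow, ← map_pow, hσ, map_one]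
    rfl
  conv_rhs => rw [← h1]
  exact (Function.Semiconj.iterate_right (f := fun g : T ⟶ X => g.left)
    (ga := fun g => g ≫ Iso.hom σ) (gb := fun g => g ≫ (Iso.hom σ).left) (fun g => rfl) r y).symm

/-! ### Configurations and the bound for their automorphism groups -/

section Config

variable {k : Subring QBar} {V : Scheme.{0}} (f : V ⟶ specOf k) (O : Set (KPoints f))

/-- The closed immersion of `Z_O` into `V`. -/
def configι : config f O ⟶ V :=
  (Scheme.IdealSheafData.vanishingIdeal (configClosed f O)).subschemeι

instance : IsClosedImmersion (configι f O) :=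
  inferInstanceAs (IsClosedImmersion (Scheme.IdealSheafData.subschemeι _))

theorem configι_comp : configι f O ≫ f = configHom f O := rfl

theorem ker_configι :
    (configι f O).ker = Scheme.IdealSheafData.vanishingIdeal (configClosed f O) :=
  Scheme.IdealSheafData.ker_subschemeι _

theorem range_configι : Set.range (configι f O) = configClosed f O :=
  (Scheme.IdealSheafData.range_subschemeι _).trans
    (Scheme.IdealSheafData.coe_support_vanishingIdeal _)

theorem ker_configι_le (y : O) : (configι f O).ker ≤ y.1.1.ker := by
  rw [ker_configι]
  exact vanishingIdeal_le_ker _ _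
    ((Set.subset_biUnion_of_mem (u := fun y : KPoints f => Set.range y.1) y.2).trans subset_closure)

/-- The section of the configuration `Z_O` given by an element of `O`. -/
def configSection (y : O) : specOf k ⟶ config f O :=
  IsClosedImmersion.lift (configι f O) y.1.1 (ker_configι_le f O y)

theorem configSection_comp (y : O) : configSection f O y ≫ configι f O = y.1.1 :=
  IsClosedImmersion.lift_fac _ _ _

theorem configSection_comp_configHom (y : O) :
    configSection f O y ≫ configHom f O = 𝟙 (specOf k) := by
  rw [← configι_comp, ← Category.assoc, configSection_comp, y.1.2]

/-- Finiteness of `O` and separatedness make the union of the sections closed, so taking the closure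
adds no points. -/
theorem exists_configSection_eq [IsSeparated f] (hO : O.Finite) (z : config f O) :
    ∃ y x, configSection f O y x = z := by
  have hz : configι f O z ∈ (configClosed f O : Set V) := by
    rw [← range_configι]
    exact ⟨z, rfl⟩
  rw [coe_configClosed f O hO, Set.mem_iUnion₂] at hz
  obtain ⟨y, hy, x, hx⟩ := hz
  refine ⟨⟨y, hy⟩, x, (configι f O).isClosedEmbedding.injective ?_⟩
  rw [← hx, ← Scheme.Hom.comp_apply, configSection_comp]

open Description in
/-- The automorphism group of a configuration in a scheme with affine charts over a ring in which
two prime numbers are no units. -/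
theorem card_configAut_le [IsSeparated f] [IsNoetherianRing k] {d : ℕ}
    (hd : ∀ b : Fin (d + 1) → k, ¬ LinearIndependent ℤ b) {p q : ℕ} (hp : p.Prime) (hq : q.Prime)
    (hpq : p ≠ q) (hpu : ¬ IsUnit (p : k)) (hqu : ¬ IsUnit (q : k)) {n : ℕ}
    (m : Fin n → ℕ) (U : Fin n → V.Opens) (hU : ∀ i, IsAffineOpen (U i)) (hcov : ⨆ i, U i = ⊤)
    (x : ∀ i, Fin (m i) → Γ(V, U i)) (hx : ∀ i, Function.Surjective (coordHom f (U i) (x i)))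
    {M : ℕ} (hpM : ∑ i, ((p ^ d) ^ 2) ^ m i ≤ M) (hqM : ∑ i, ((q ^ d) ^ 2) ^ m i ≤ M)
    (hO : O.Finite) :
    Finite (ConfigAut f O) ∧ Nat.card (ConfigAut f O) ≤ M ^ M * M ^ M := by
  have : Finite O := hO
  have hsep : IsSeparated (configHom f O) := by rw [← configι_comp]; infer_instance
  have hred : IsReduced (config f O) := isReduced_subscheme_vanishingIdeal _
  have hfin : Finite (ConfigAut f O) := finite_aut_of_sections (configHom f O) (configSection f O)
    (configSection_comp_configHom f O) (exists_configSection_eq f O hO)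
  refine ⟨hfin, ?_⟩
  have key : ∀ {p : ℕ}, p.Prime → ¬ IsUnit (p : k) → ∑ i, ((p ^ d) ^ 2) ^ m i ≤ M →
      ∃ (X : Type) (_ : Finite X) (φ : ConfigAut f O →* Equiv.Perm X), Nat.card X ≤ M ∧
        ∀ σ r, r.Coprime p → σ ^ r = 1 → φ σ = 1 → σ = 1 := by
    intro p hp hpu hpM
    obtain ⟨R, _, _, _, _, hRcard, hR⟩ := exists_detecting_algebra hd hp hpu
    let t : Spec (.of R) ⟶ specOf k := Spec.map (CommRingCat.ofHom (algebraMap k R))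
    -- Embedding `Z_O(R)` into `V(R)` is what makes the bound independent of `O`.
    let E : (Over.mk t ⟶ Over.mk (configHom f O)) → {g : Spec (.of R) ⟶ V // g ≫ f = t} :=
      fun g => ⟨g.left ≫ configι f O,
        (Category.assoc _ _ _).trans (Over.w g)⟩
    have hE : Function.Injective E := fun g g' hgg =>
      Over.OverMorphism.ext ((cancel_mono _).1 (congrArg Subtype.val hgg))
    obtain ⟨hfinV, hcardV⟩ := card_points_le f m U hU hcov x hx R t
    refine ⟨_, Finite.of_injective E hE, autPerm (Over.mk t) (Over.mk (configHom f O)),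
      (Nat.card_le_card_of_injective E hE).trans (hcardV.trans (le_trans ?_ hpM)), ?_⟩
    · exact Finset.sum_le_sum fun i _ => Nat.pow_le_pow_left hRcard _
    · intro σ r hr hσ hφ
      refine Iso.ext (Over.OverMorphism.ext ?_)
      refine eq_of_comp_sections_eq (configHom f O) (configSection f O)
        (exists_configSection_eq f O hO) ((Over.w (Iso.hom σ)).trans (Category.id_comp _).symm)
        fun y => ?_
      rw [show (Iso.hom (1 : ConfigAut f O)).left = 𝟙 (config f O) from rfl, Category.comp_id]
      refine hR (config f O) (configHom f O) (Iso.hom σ).left (Over.w (Iso.hom σ))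
        (fun g hg => ?_) r hr _ (configSection_comp_configHom f O y) ?_
      · have h1 := congrArg (fun e => (e (Over.homMk (U := Over.mk t) g hg)).left) hφ
        exact h1
      · exact iterate_comp_hom_left σ hσ (T := Over.mk (𝟙 _))
          (Over.homMk (configSection f O y) (configSection_comp_configHom f O y))
  obtain ⟨X, _, φ, hX, hφ⟩ := key hp hpu hpM
  obtain ⟨Y, _, ψ, hY, hψ⟩ := key hq hqu hqM
  exact card_group_le φ ψ hp hq hpq hφ hψ hX hY

end Config

/-! ### Numbers read off from a description -/

theorem coeff_densePoly (c : List ℤ) (j : ℕ) : (densePoly c).coeff j = c.getD j 0 := by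
  rw [densePoly, Polynomial.finsetSum_coeff]
  simp only [Polynomial.coeff_C_mul_X_pow]
  by_cases hj : j < c.length
  · rw [Finset.sum_eq_single_of_mem j (Finset.mem_range.2 hj)]
    · simp
    · intro i _ hij
      rw [if_neg (Ne.symm hij)]
  · rw [Finset.sum_eq_zero, List.getD_eq_default _ _ (not_lt.1 hj)]
    intro i hi
    rw [if_neg]
    rintro rfl
    exact hj (Finset.mem_range.1 hi)

theorem natDegree_densePoly_le (c : List ℤ) : (densePoly c).natDegree ≤ c.length := by
  rw [Polynomial.natDegree_le_iff_coeff_eq_zero]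
  intro j hj
  rw [coeff_densePoly, List.getD_eq_default _ _ hj.le]

namespace Description

/-- A multiple of the leading coefficient of the minimal polynomial and of all denominators. -/
def denominator (D : Description) : ℕ :=
  (D.minPoly.map fun c => max 1 c.natAbs).prod * (D.gens.map Prod.snd).prod

/-- The coefficient list may end in zeros, so the leading coefficient need not be its last entry.
The product therefore runs over all entries, with zeros replaced by `1`. -/
theorem leadingCoeff_dvd_denominator (D : Description) (h : densePoly D.minPoly ≠ 0) :
    (densePoly D.minPoly).leadingCoeff ∣ (D.denominator : ℤ) := by
  set c := (densePoly D.minPoly).leadingCoeff with hc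
  have hc0 : c ≠ 0 := Polynomial.leadingCoeff_ne_zero.2 h
  have hmem : c ∈ D.minPoly := by
    rw [hc, Polynomial.leadingCoeff, coeff_densePoly] at hc0 ⊢
    by_cases hj : (densePoly D.minPoly).natDegree < D.minPoly.length
    · rw [List.getD_eq_getElem _ _ hj]
      exact List.getElem_mem hj
    · exact absurd (List.getD_eq_default _ _ (not_lt.1 hj)) hc0
  rw [← Int.natAbs_dvd, Int.natCast_dvd_natCast]
  refine Dvd.dvd.mul_right (List.dvd_prod (List.mem_map.2 ⟨c, hmem, ?_⟩)) _
  exact max_eq_right (Nat.one_le_iff_ne_zero.2 (Int.natAbs_ne_zero.2 hc0))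

theorem gens_dvd_denominator (D : Description) (i : Fin D.gens.length) :
    (D.gens.get i).2 ∣ D.denominator :=
  Dvd.dvd.mul_left (List.dvd_prod (List.mem_map.2 ⟨_, List.get_mem _ i, rfl⟩)) _

variable {D : Description} {k : Subring QBar} {a : Fin D.gens.length → k}

theorem DescribesRing.denominator_pos (h : D.DescribesRing k a) : 0 < D.denominator := by
  obtain ⟨⟨θ, -, -, ha⟩, -⟩ := h
  refine Nat.mul_pos (List.prod_pos ?_) (List.prod_pos ?_)
  · intro n hn
    obtain ⟨c, -, rfl⟩ := List.mem_map.1 hn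
    exact lt_max_of_lt_left one_pos
  · intro n hn
    obtain ⟨g, hg, rfl⟩ := List.mem_map.1 hn
    obtain ⟨i, rfl⟩ := List.get_of_mem hg
    exact (ha i).1

theorem DescribesRing.le_of_forall_mem (h : D.DescribesRing k a) (B : Subring QBar)
    (hB : ∀ i, (a i : QBar) ∈ B) (b : k) : (b : QBar) ∈ B := by
  have h1 : Subring.closure (Set.range a) ≤ B.comap k.subtype := by
    rw [Subring.closure_le]
    rintro _ ⟨i, rfl⟩
    exact hB i
  rw [h.2] at h1
  exact h1 (Subring.mem_top b)

/-- The ring `k` lies in `ℚ(θ)`, whose degree is at most that of the given polynomial, and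
independence over `ℤ` implies independence over `ℚ`. -/
theorem DescribesRing.not_linearIndependent (h : D.DescribesRing k a)
    (b : Fin (D.minPoly.length + 1) → k) : ¬ LinearIndependent ℤ b := by
  intro hb
  obtain ⟨θ, hirr, hθ, ha⟩ := id h.1
  have hne : (densePoly D.minPoly).map (Int.castRingHom ℚ) ≠ 0 :=
    (Polynomial.map_ne_zero_iff Int.cast_injective).2 hirr.ne_zero
  have hθ' : Polynomial.aeval θ ((densePoly D.minPoly).map (Int.castRingHom ℚ)) = 0 := by
    rw [← hθ]
    exact Polynomial.aeval_map_algebraMap ℚ θ _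
  have hint : IsIntegral ℚ θ :=
    ((AlgebraicClosure.isAlgebraic ℚ).isAlgebraic θ).isIntegral
  have hmem : ∀ b : k, (b : QBar) ∈ IntermediateField.adjoin ℚ {θ} := by
    refine h.le_of_forall_mem (IntermediateField.adjoin ℚ {θ}).toSubring fun i => ?_
    rw [(ha i).2]
    refine (IntermediateField.adjoin ℚ {θ}).div_mem ?_ (natCast_mem _ _)
    rw [← Polynomial.aeval_map_algebraMap ℚ]
    exact IntermediateField.algebra_adjoin_le_adjoin ℚ {θ}
      (Polynomial.aeval_mem_adjoin_singleton ℚ θ)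
  have h1 : LinearIndependent ℤ (fun i => (b i : QBar)) :=
    hb.map' k.subtype.toAddMonoidHom.toIntLinearMap
      (LinearMap.ker_eq_bot.2 Subtype.val_injective)
  rw [LinearIndependent.iff_fractionRing ℤ ℚ] at h1
  let b' : Fin (D.minPoly.length + 1) → IntermediateField.adjoin ℚ {θ} := fun i => ⟨b i, hmem _⟩
  have h2 : LinearIndependent ℚ b' :=
    LinearIndependent.of_comp (IntermediateField.adjoin ℚ {θ}).val.toLinearMap h1
  have : FiniteDimensional ℚ (IntermediateField.adjoin ℚ {θ}) :=
    IntermediateField.adjoin.finiteDimensional hint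
  have h3 := h2.fintype_card_le_finrank
  rw [IntermediateField.adjoin.finrank hint, Fintype.card_fin] at h3
  have h4 := Polynomial.natDegree_le_of_dvd (minpoly.dvd ℚ θ hθ') hne
  have h5 := Polynomial.natDegree_map_le (p := densePoly D.minPoly) (f := Int.castRingHom ℚ)
  have h6 := natDegree_densePoly_le D.minPoly
  omega

end Description

/-- The elements of a commutative ring that become integral after multiplication by a power of
`N`. -/
def powMulIntegral (R : Type) [CommRing R] (N : ℕ) : Subalgebra ℤ R where
  carrier := {b | ∃ e : ℕ, IsIntegral ℤ ((N : R) ^ e * b)}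
  mul_mem' := by
    rintro b c ⟨e, he⟩ ⟨e', he'⟩
    refine ⟨e + e', ?_⟩
    rw [pow_add, mul_mul_mul_comm]
    exact he.mul he'
  add_mem' := by
    rintro b c ⟨e, he⟩ ⟨e', he'⟩
    refine ⟨e + e', ?_⟩
    have hN : ∀ e : ℕ, IsIntegral ℤ ((N : R) ^ e) := fun e => by
      rw [← Nat.cast_pow, ← map_natCast (algebraMap ℤ R)]
      exact isIntegral_algebraMap
    have h : (N : R) ^ (e + e') * (b + c) = N ^ e' * (N ^ e * b) + N ^ e * (N ^ e' * c) := by ring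
    rw [h]
    exact ((hN _).mul he).add ((hN _).mul he')
  algebraMap_mem' n := ⟨0, by rw [pow_zero, one_mul]; exact isIntegral_algebraMap⟩

/-- A root times the leading coefficient is integral. -/
theorem mem_powMulIntegral_of_root {R : Type} [CommRing R] {P : Polynomial ℤ} {θ : R}
    (hθ : P.eval₂ (Int.castRingHom R) θ = 0) {N : ℕ} (hN : P.leadingCoeff ∣ N) :
    θ ∈ powMulIntegral R N := by
  refine ⟨1, ?_⟩
  obtain ⟨c, hc⟩ := hN
  have h1 : IsIntegral ℤ (P.leadingCoeff • θ) := isIntegral_leadingCoeff_smul _ _ hθ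
  have h2 := h1.smul c
  rw [smul_smul, mul_comm c, ← hc] at h2
  simpa [zsmul_eq_mul] using h2

theorem eval₂_mem_powMulIntegral {R : Type} [CommRing R] {N : ℕ} {θ : R}
    (hθ : θ ∈ powMulIntegral R N) (P : Polynomial ℤ) :
    P.eval₂ (Int.castRingHom R) θ ∈ powMulIntegral R N :=
  (Algebra.adjoin_singleton_le hθ) (Polynomial.aeval_mem_adjoin_singleton ℤ θ (p := P))

theorem inv_mem_powMulIntegral {L : Type} [Field L] [CharZero L] {N d : ℕ} (hd : 0 < d)
    (hN : d ∣ N) : (d : L)⁻¹ ∈ powMulIntegral L N := by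
  obtain ⟨c, rfl⟩ := hN
  have hd : (d : L) ≠ 0 := Nat.cast_ne_zero.2 hd.ne'
  refine ⟨1, ?_⟩
  rw [pow_one, Nat.cast_mul, mul_right_comm, mul_inv_cancel₀ hd, one_mul,
    ← map_natCast (algebraMap ℤ L)]
  exact isIntegral_algebraMap

/-- The rational number `N ^ e / p` is integral over `ℤ`, hence an integer. -/
theorem prime_dvd_of_inv_mem_powMulIntegral {L : Type} [Field L] [CharZero L] {N p : ℕ}
    (hp : p.Prime) (h : (p : L)⁻¹ ∈ powMulIntegral L N) : p ∣ N := by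
  obtain ⟨e, he⟩ := h
  have h0 : (N : L) ^ e * (p : L)⁻¹ = algebraMap ℚ L ((N : ℚ) ^ e * (p : ℚ)⁻¹) := by simp
  rw [h0, isIntegral_algebraMap_iff (algebraMap ℚ L).injective] at he
  obtain ⟨n, hn⟩ := IsIntegrallyClosed.isIntegral_iff.1 he
  have hp0 : (p : ℚ) ≠ 0 := Nat.cast_ne_zero.2 hp.ne_zero
  have h1 : (N : ℤ) ^ e = p * n := by
    have h2 : ((N : ℚ)) ^ e = p * n := by
      rw [show (n : ℚ) = _ from hn]
      field_simp
    exact_mod_cast h2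
  refine hp.dvd_of_dvd_pow (n := e) (Int.natCast_dvd_natCast.1 ?_)
  rw [Nat.cast_pow]
  exact ⟨n, h1⟩

/-- A prime number that does not divide the denominator of a description is not invertible. -/
theorem Description.DescribesRing.not_isUnit_prime {D : Description} {k : Subring QBar}
    {a : Fin D.gens.length → k} (h : D.DescribesRing k a) {p : ℕ} (hp : p.Prime)
    (hpN : ¬ p ∣ D.denominator) : ¬ IsUnit (p : k) := by
  intro hpu
  obtain ⟨θ, hirr, hθ, ha⟩ := id h.1
  have haeval : ∀ P : Polynomial ℤ, Polynomial.aeval θ P = P.eval₂ (Int.castRingHom QBar) θ :=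
    fun P => by rw [Polynomial.aeval_def, RingHom.eq_intCast' (algebraMap ℤ QBar)]
  have hθB : θ ∈ powMulIntegral QBar D.denominator :=
    mem_powMulIntegral_of_root (by rw [← haeval, hθ]) (D.leadingCoeff_dvd_denominator hirr.ne_zero)
  -- It suffices to bound the denominators of the generators. An inverse of `p` in `k` would then
  -- force `p` to divide `N`.
  have hkB : ∀ b : k, (b : QBar) ∈ powMulIntegral QBar D.denominator := by
    refine h.le_of_forall_mem (powMulIntegral QBar D.denominator).toSubring fun i => ?_
    rw [(ha i).2, div_eq_mul_inv, haeval]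
    exact (powMulIntegral QBar _).mul_mem (eval₂_mem_powMulIntegral hθB _)
      (inv_mem_powMulIntegral (ha i).1 (D.gens_dvd_denominator i))
  obtain ⟨u, hu⟩ := hpu.exists_right_inv
  have hu' : (u : QBar) = (p : QBar)⁻¹ := by
    refine eq_inv_of_mul_eq_one_right ?_
    exact_mod_cast congrArg Subtype.val hu
  exact hpN (prime_dvd_of_inv_mem_powMulIntegral hp (hu' ▸ hkB u))

/-! ### Computability of the bound -/

theorem primrec_natAbs : Primrec Int.natAbs := by
  -- Integers are coded by `n ↦ 2 n` and `-(n + 1) ↦ 2 n + 1`.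
  have h : ∀ c : ℤ, c.natAbs = (Encodable.encode c + 1) / 2 := by
    intro c
    cases c with
    | ofNat n =>
      have : Encodable.encode (Int.ofNat n) = 2 * n := rfl
      rw [this]; simp; omega
    | negSucc n =>
      have : Encodable.encode (Int.negSucc n) = 2 * n + 1 := rfl
      rw [this]; simp; omega
  exact (Primrec.nat_div.comp (Primrec.succ.comp Primrec.encode) (Primrec.const 2)).of_eq
    fun c => (h c).symm

theorem primrec_pow : Primrec₂ ((· ^ ·) : ℕ → ℕ → ℕ) :=
  Primrec₂.unpaired'.1 Nat.Primrec.pow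

theorem primrec_list_prod : Primrec (List.prod : List ℕ → ℕ) :=
  Primrec.list_foldr (f := id) (g := fun _ => 1) (h := fun _ q => q.1 * q.2) Primrec.id
    (Primrec.const 1) (Primrec.nat_mul.comp (Primrec.fst.comp Primrec.snd)
      (Primrec.snd.comp Primrec.snd)) |>.of_eq fun _ => (List.prod_eq_foldr).symm

theorem primrec_list_sum : Primrec (List.sum : List ℕ → ℕ) :=
  Primrec.list_foldr (f := id) (g := fun _ => 0) (h := fun _ q => q.1 + q.2) Primrec.id
    (Primrec.const 0) (Primrec.nat_add.comp (Primrec.fst.comp Primrec.snd)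
      (Primrec.snd.comp Primrec.snd)) |>.of_eq fun _ => (List.sum_eq_foldr).symm

namespace Description

theorem primrec_equivProd : Primrec Description.equivProd :=
  Primrec.of_equiv

theorem primrec_denominator : Primrec denominator := by
  refine Primrec.nat_mul.comp (primrec_list_prod.comp (Primrec.list_map
    (Primrec.fst.comp primrec_equivProd) ?_)) (primrec_list_prod.comp (Primrec.list_map
    (Primrec.fst.comp (Primrec.snd.comp primrec_equivProd)) ?_))
  · exact (Primrec.nat_max.comp (Primrec.const 1) (primrec_natAbs.comp Primrec.snd)).to₂
  · exact (Primrec.snd.comp Primrec.snd).to₂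

/-- A bound for the number of points over certain finite local rings. -/
def pointBound (D : Description) : ℕ :=
  D.charts.length * (((D.denominator * (D.denominator + 1) + 1) ^ D.minPoly.length) ^ 2) ^
    (D.charts.map Prod.fst).sum

theorem primrec_pointBound : Primrec pointBound := by
  have hcharts : Primrec fun D : Description => D.charts :=
    Primrec.fst.comp (Primrec.snd.comp (Primrec.snd.comp primrec_equivProd))
  have hmin : Primrec fun D : Description => D.minPoly := Primrec.fst.comp primrec_equivProd
  have hden := primrec_denominator
  have hnum : Primrec fun D : Description => D.denominator * (D.denominator + 1) + 1 :=
    Primrec.succ.comp (Primrec.nat_mul.comp hden (Primrec.succ.comp hden))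
  refine Primrec.nat_mul.comp (Primrec.list_length.comp hcharts) (primrec_pow.comp
    (primrec_pow.comp (primrec_pow.comp hnum (Primrec.list_length.comp hmin)) (Primrec.const 2))
    (primrec_list_sum.comp (Primrec.list_map hcharts ?_)))
  exact (Primrec.fst.comp Primrec.snd).to₂

/-- The bound for the number of automorphisms of configurations. -/
def autBound (D : Description) : ℕ :=
  D.pointBound ^ D.pointBound * D.pointBound ^ D.pointBound

theorem computable_autBound : Computable autBound := by
  have h := primrec_pow.comp primrec_pointBound primrec_pointBound
  exact (Primrec.nat_mul.comp h h).to_comp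

/-- The sum of all numbers of coordinates serves as a common exponent for the charts, and `N (N + 1)
+ 1` as a common bound for the two primes. -/
theorem sum_le_pointBound (D : Description) {p : ℕ}
    (h : p ≤ D.denominator * (D.denominator + 1) + 1) :
    ∑ i, ((p ^ D.minPoly.length) ^ 2) ^ D.numCoords i ≤ D.pointBound := by
  calc ∑ i, ((p ^ D.minPoly.length) ^ 2) ^ D.numCoords i
      ≤ ∑ _i : Fin D.numCharts, (((D.denominator * (D.denominator + 1) + 1) ^
          D.minPoly.length) ^ 2) ^ (D.charts.map Prod.fst).sum := by
        refine Finset.sum_le_sum fun i _ => ?_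
        refine (Nat.pow_le_pow_left (Nat.pow_le_pow_left (Nat.pow_le_pow_left h _) _) _).trans
          (Nat.pow_le_pow_right (by positivity) ?_)
        exact List.single_le_sum (fun _ _ => Nat.zero_le _) _
          (List.mem_map.2 ⟨_, List.get_mem _ i, rfl⟩)
    _ = D.pointBound := by
        rw [Finset.sum_const, Finset.card_univ, Fintype.card_fin, smul_eq_mul, pointBound]

theorem Describes.card_configAut_le {D : Description} {k : Subring QBar} [IsNoetherianRing k]
    {V : Scheme.{0}} {f : V ⟶ specOf k} [IsSeparated f] (h : D.Describes f) (O : Set (KPoints f))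
    (hO : O.Finite) : Finite (ConfigAut f O) ∧ Nat.card (ConfigAut f O) ≤ D.autBound := by
  obtain ⟨a, U, x, hring, hU, hcov, hx, -, -⟩ := h
  set N := D.denominator with hN
  have hN0 : 0 < N := hring.denominator_pos
  -- As in Euclid's proof, a prime factor `p` of `N + 1` does not divide `N`, and a prime factor `q`
  -- of `N p + 1` divides neither `N` nor `p`.
  have hp : (N + 1).minFac.Prime := Nat.minFac_prime (by omega)
  have hpN : ¬ (N + 1).minFac ∣ N := fun h =>
    hp.one_lt.ne' (Nat.dvd_one.1 ((Nat.dvd_add_right h).1 (Nat.minFac_dvd _)))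
  set p := (N + 1).minFac
  have hpN' : p ≤ N + 1 := Nat.minFac_le (Nat.succ_pos _)
  have hNp : 0 < N * p := Nat.mul_pos hN0 hp.pos
  have hq : (N * p + 1).minFac.Prime := Nat.minFac_prime (by omega)
  have hqNp : ¬ (N * p + 1).minFac ∣ N * p := fun h =>
    hq.one_lt.ne' (Nat.dvd_one.1 ((Nat.dvd_add_right h).1 (Nat.minFac_dvd _)))
  have hqle : (N * p + 1).minFac ≤ N * p + 1 := Nat.minFac_le (Nat.succ_pos _)
  set q := (N * p + 1).minFac
  have hqN : ¬ q ∣ N := fun h => hqNp (h.mul_right p)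
  have hpq : p ≠ q := fun h => hqNp (h ▸ Dvd.intro_left N rfl)
  refine _root_.card_configAut_le f O hring.not_linearIndependent hp hq hpq
    (hring.not_isUnit_prime hp hpN) (hring.not_isUnit_prime hq hqN) D.numCoords U hU hcov x hx
    (D.sum_le_pointBound ?_) (D.sum_le_pointBound ?_) hO
  · exact hpN'.trans (Nat.succ_le_succ (Nat.le_mul_of_pos_left _ hN0) |>.trans' (by nlinarith))
  · exact hqle.trans (Nat.succ_le_succ (Nat.mul_le_mul_left N hpN'))

end Description

/-! ### Existence of descriptions -/

theorem exists_densePoly_eq (P : Polynomial ℤ) : ∃ c, densePoly c = P := by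
  refine ⟨(List.range (P.natDegree + 1)).map P.coeff, ?_⟩
  ext j
  rw [coeff_densePoly]
  by_cases hj : j < P.natDegree + 1
  · rw [List.getD_eq_getElem _ _ (by simpa using hj)]
    simp
  · rw [List.getD_eq_default _ _ (by simpa using hj), Polynomial.coeff_eq_zero_of_natDegree_lt]
    omega

theorem exists_int_polynomial_div (P : Polynomial ℚ) : ∃ (Q : Polynomial ℤ) (d : ℕ), 0 < d ∧
    ∀ θ : QBar, Polynomial.aeval θ P = Polynomial.aeval θ Q / (d : QBar) := by
  obtain ⟨b, hb, hP⟩ := IsLocalization.integerNormalization_spec (nonZeroDivisors ℤ) P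
  set Q := IsLocalization.integerNormalization (nonZeroDivisors ℤ) P
  have hb0 : b ≠ 0 := nonZeroDivisors.ne_zero hb
  -- The common denominator `b` may be negative; expanding the fraction by `b` makes it positive.
  refine ⟨Polynomial.C b * Q, b.natAbs ^ 2, by positivity, fun θ => ?_⟩
  have h1 : Polynomial.aeval θ Q = (b : QBar) * Polynomial.aeval θ P := by
    rw [← Polynomial.aeval_map_algebraMap ℚ, hP, zsmul_eq_mul, map_mul, map_intCast]
  have h2 : ((b.natAbs ^ 2 : ℕ) : QBar) = (b : QBar) ^ 2 := by
    rw [← Int.cast_natCast, Nat.cast_pow, Int.natAbs_sq, Int.cast_pow]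
  have hb0' : (b : QBar) ≠ 0 := Int.cast_ne_zero.2 hb0
  rw [map_mul, h1, h2, Polynomial.aeval_C, eq_intCast]
  field_simp

/-- The polynomials that vanish at `θ` form a nonzero prime ideal of the factorial ring `ℤ[T]`, so
it contains a prime element. -/
theorem exists_irreducible_int_polynomial (θ : QBar) :
    ∃ P : Polynomial ℤ, Irreducible P ∧ Polynomial.aeval θ P = 0 := by
  have hθ : IsAlgebraic ℤ θ :=
    (IsFractionRing.isAlgebraic_iff ℤ ℚ QBar).2 ((AlgebraicClosure.isAlgebraic ℚ).isAlgebraic θ)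
  obtain ⟨Q, hQ, hQθ⟩ := hθ
  have hI : (RingHom.ker (Polynomial.aeval (R := ℤ) θ)).IsPrime := RingHom.ker_isPrime _
  obtain ⟨P, hP, hPp⟩ := hI.exists_mem_prime_of_ne_bot (Submodule.ne_bot_iff _ |>.2 ⟨Q, hQθ, hQ⟩)
  exact ⟨P, hPp.irreducible, hP⟩

theorem exists_primitive_element_aeval {n : ℕ} (a : Fin n → QBar) :
    ∃ θ : QBar, ∀ i, ∃ P : Polynomial ℚ, Polynomial.aeval θ P = a i := by
  let K := IntermediateField.adjoin ℚ (Set.range a)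
  have hint : ∀ x : QBar, IsIntegral ℚ x := fun x =>
    ((AlgebraicClosure.isAlgebraic ℚ).isAlgebraic x).isIntegral
  have : FiniteDimensional ℚ K := by
    have : Finite (Set.range a) := Set.finite_range a
    exact IntermediateField.finiteDimensional_adjoin fun x _ => hint x
  obtain ⟨α, hα⟩ := Field.exists_primitive_element ℚ K
  refine ⟨α, fun i => ?_⟩
  have h1 : (⟨a i, IntermediateField.subset_adjoin ℚ _ ⟨i, rfl⟩⟩ : K) ∈ Algebra.adjoin ℚ {α} := by
    rw [← IntermediateField.adjoin_simple_toSubalgebra_of_isAlgebraic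
      (Algebra.IsAlgebraic.isAlgebraic (R := ℚ) α), hα]
    trivial
  rw [Algebra.adjoin_singleton_eq_range_aeval] at h1
  obtain ⟨P, hP⟩ := h1
  exact ⟨P, (Polynomial.aeval_algebraMap_apply QBar α P).trans (congrArg (algebraMap K QBar) hP)⟩

/-- A primitive element of the field of the generators serves as `θ`. The charts and the gluing data
stay arbitrary because they are chosen later, in terms of the generators `a`. -/
theorem exists_describesRing (k : Subring QBar) (hk : Algebra.FiniteType ℤ k) :
    ∃ (c : List ℤ) (gens : List (List ℤ × ℕ)) (a : Fin gens.length → k), ∀ charts glue,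
      Description.DescribesRing ⟨c, gens, charts, glue⟩ k a := by
  obtain ⟨s, hs⟩ := hk.out
  let a : Fin s.card → k := fun i => s.equivFin.symm i
  have ha : Subring.closure (Set.range a) = ⊤ := by
    have h1 : Set.range a = s := by
      ext x
      constructor
      · rintro ⟨i, rfl⟩
        exact (s.equivFin.symm i).2
      · intro hx
        exact ⟨s.equivFin ⟨x, hx⟩, by simp [a]⟩
    rw [h1]
    rw [Algebra.adjoin_int] at hs
    exact SetLike.ext fun x => SetLike.ext_iff.1 hs x
  obtain ⟨θ, hθ⟩ := exists_primitive_element_aeval fun i => (a i : QBar)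
  have hrep : ∀ i, ∃ g : List ℤ × ℕ, 0 < g.2 ∧
      (a i : QBar) = Polynomial.aeval θ (densePoly g.1) / (g.2 : QBar) := by
    intro i
    obtain ⟨P, hP⟩ := hθ i
    obtain ⟨Q, d, hd, hQ⟩ := exists_int_polynomial_div P
    obtain ⟨c, rfl⟩ := exists_densePoly_eq Q
    exact ⟨(c, d), hd, hP.symm.trans (hQ θ)⟩
  choose g hg using hrep
  obtain ⟨P, hP, hPθ⟩ := exists_irreducible_int_polynomial θ
  obtain ⟨c, rfl⟩ := exists_densePoly_eq P
  have hlen : (List.ofFn g).length = s.card := List.length_ofFn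
  refine ⟨c, List.ofFn g, fun i => a (i.cast hlen), fun charts glue =>
    ⟨⟨θ, hP, hPθ, fun i => ?_⟩, ?_⟩⟩
  · have h1 : (List.ofFn g).get i = g (i.cast hlen) := List.get_ofFn g i
    change 0 < ((List.ofFn g).get i).2 ∧
      _ = Polynomial.aeval θ (densePoly ((List.ofFn g).get i).1) /
      (((List.ofFn g).get i).2 : QBar)
    rw [h1]
    exact hg _
  · rw [← ha]
    congr 1
    exact (finCongr hlen).surjective.range_comp a

/-- A ring generated by the entries of `v` is the image of a polynomial ring over `ℤ`; the terms of
a preimage of `s` are listed. -/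
theorem SparsePoly.exists_eval_eq {R : Type} [CommRing R] (v : List R)
    (hv : Subring.closure {x | x ∈ v} = ⊤) (s : R) : ∃ P : SparsePoly, P.eval v = s := by
  have hs : s ∈ (MvPolynomial.aeval (R := ℤ) v.get).range := by
    rw [← Algebra.adjoin_range_eq_range_aeval, Set.range_list_get, Algebra.adjoin_int]
    have h : s ∈ Subring.closure {x | x ∈ v} := hv ▸ Subring.mem_top s
    exact h
  obtain ⟨Q, rfl⟩ := hs
  refine ⟨Q.support.toList.map fun e => (Q.coeff e, List.ofFn e), ?_⟩
  rw [SparsePoly.eval, List.map_map, Finset.sum_map_toList]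
  change _ = MvPolynomial.eval₂ _ _ _
  rw [MvPolynomial.eval₂_eq']
  refine Finset.sum_congr rfl fun e _ => ?_
  have h : List.zipWith (fun (a : R) e => a ^ e) v (List.ofFn e) =
      List.ofFn fun i => v.get i ^ e i := by
    refine List.ext_getElem (by simp) fun i h1 h2 => ?_
    simp
  simp [h, List.prod_ofFn]

theorem exists_toMvPolynomial_eq {k : Subring QBar} {m : ℕ} (a : Fin m → k)
    (ha : Subring.closure (Set.range a) = ⊤) (n : ℕ) (F : MvPolynomial (Fin n) k) :
    ∃ P, Description.toMvPolynomial a n P = F := by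
  refine SparsePoly.exists_eval_eq _ ?_ F
  set T := Subring.closure {x : MvPolynomial (Fin n) k |
    x ∈ List.ofFn (fun i => MvPolynomial.C (a i)) ++ List.ofFn MvPolynomial.X}
  have hC : ∀ c : k, MvPolynomial.C c ∈ T := by
    have h : Subring.closure (Set.range a) ≤ T.comap MvPolynomial.C := by
      rw [Subring.closure_le]
      rintro _ ⟨i, rfl⟩
      refine Subring.subset_closure (List.mem_append_left _ ?_)
      exact (List.mem_ofFn' _ _).2 ⟨i, rfl⟩
    rw [ha] at h
    exact fun c => h (Subring.mem_top c)
  have hX : ∀ i, MvPolynomial.X i ∈ T := fun i =>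
    Subring.subset_closure (List.mem_append_right _ ((List.mem_ofFn' _ _).2 ⟨i, rfl⟩))
  refine (Subring.eq_top_iff' _).2 fun F => ?_
  induction F using MvPolynomial.induction_on with
  | C c => exact hC c
  | add p q hp hq => exact T.add_mem hp hq
  | mul_X p i hp => exact T.mul_mem hp (hX i)

open Description in
/-- The affine open subsets of a scheme locally of finite type are described by finitely many
equations. -/
theorem exists_chart {k : Subring QBar} [IsNoetherianRing k] {V : Scheme.{0}} (f : V ⟶ specOf k)
    [LocallyOfFiniteType f] {m : ℕ} {a : Fin m → k} (ha : Subring.closure (Set.range a) = ⊤)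
    {U : V.Opens} (hU : IsAffineOpen U) :
    ∃ (c : ℕ × List SparsePoly) (x : Fin c.1 → Γ(V, U)), Function.Surjective (coordHom f U x) ∧
      RingHom.ker (coordHom f U x) =
        Ideal.span {F | ∃ P ∈ c.2, F = toMvPolynomial a c.1 P} := by
  have hft : (structureHom f U).FiniteType := by
    have h1 : (f.appLE ⊤ U le_top).hom.FiniteType :=
      f.finiteType_appLE (isAffineOpen_top _) hU le_top
    have h2 : ((Scheme.ΓSpecIso (CommRingCat.of k)).inv).hom.FiniteType :=
      .of_surjective _
        (Scheme.ΓSpecIso (CommRingCat.of k)).symm.commRingCatIsoToRingEquiv.surjective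
    exact h1.comp h2
  algebraize [structureHom f U]
  obtain ⟨n, g, hg⟩ := Algebra.FiniteType.iff_quotient_mvPolynomial''.1 hft
  have hgx : (g : MvPolynomial (Fin n) k →+* Γ(V, U)) =
      coordHom f U (fun i => g (MvPolynomial.X i)) := by
    refine MvPolynomial.ringHom_ext (fun c => ?_) fun i => ?_
    · exact (g.commutes c).trans (MvPolynomial.eval₂_C _ _ _).symm
    · simp [coordHom]
  -- Hilbert's basis theorem provides finitely many equations.
  obtain ⟨s, hs⟩ := IsNoetherian.noetherian
    (RingHom.ker (coordHom f U (fun i => g (MvPolynomial.X i))))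
  choose E hE using exists_toMvPolynomial_eq a ha n
  refine ⟨(n, s.toList.map E), fun i => g (MvPolynomial.X i), ?_, ?_⟩
  · rw [← hgx]; exact hg
  · rw [← hs]
    change Ideal.span _ = Ideal.span _
    congr 1
    ext F
    simp only [Set.mem_ofPred_eq, List.mem_map, Finset.mem_toList]
    constructor
    · exact fun hF => ⟨E F, ⟨F, hF, rfl⟩, (hE F).symm⟩
    · rintro ⟨_, ⟨F', hF', rfl⟩, rfl⟩
      rw [hE]
      exact hF'

/-- On a basic open subset of one chart that is contained in another chart, the coordinates of the
latter are fractions in the coordinates of the former. -/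
theorem exists_gluePiece {V : Scheme.{0}} {U U' : V.Opens} (hU : IsAffineOpen U)
    (val : SparsePoly → Γ(V, U)) (hval : Function.Surjective val) {n : ℕ} (x' : Fin n → Γ(V, U'))
    (h : Γ(V, U)) (hh : V.basicOpen h ≤ U') :
    ∃ t : GluePiece, val t.1 = h ∧ ∃ hj : V.basicOpen (val t.1) ≤ U', ∀ l : Fin n,
      V.presheaf.map (homOfLE (V.basicOpen_le (val t.1))).op (val t.1) ^ t.2.1 *
          V.presheaf.map (homOfLE hj).op (x' l) =
        V.presheaf.map (homOfLE (V.basicOpen_le (val t.1))).op (val (t.2.2.getD l [])) := by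
  obtain ⟨P, rfl⟩ := hval h
  have hloc := hU.isLocalization_basicOpen (val P)
  let _ : Algebra Γ(V, U) Γ(V, V.basicOpen (val P)) :=
    (V.presheaf.map (homOfLE (V.basicOpen_le (val P))).op).hom.toAlgebra
  -- Functions on the basic open subset are fractions with powers of `h` as denominators; finitely
  -- many coordinates have a common exponent `e`.
  obtain ⟨⟨_, e, rfl⟩, hb⟩ := IsLocalization.exist_integer_multiples_of_finite
    (Submonoid.powers (val P)) (fun l => V.presheaf.map (homOfLE hh).op (x' l))
  choose y hy using hb
  choose E hE using hval
  refine ⟨(P, e, List.ofFn fun l => E (y l)), rfl, hh, fun l => ?_⟩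
  have h1 := hy l
  have h2 : (List.ofFn fun l => E (y l)).getD l [] = E (y l) := by
    rw [List.getD_eq_getElem _ _ (by simp)]
    simp
  rw [h2, hE]
  rw [Algebra.smul_def, RingHom.map_pow] at h1
  exact h1.symm

/-- The intersection of two charts is described by finitely many pieces. -/
theorem exists_gluePieces {V : Scheme.{0}} [QuasiSeparatedSpace V] {U U' : V.Opens}
    (hU : IsAffineOpen U) (hU' : IsAffineOpen U')
    (val : SparsePoly → Γ(V, U)) (hval : Function.Surjective val) {n : ℕ} (x' : Fin n → Γ(V, U')) :
    ∃ L : List GluePiece, U ⊓ U' = (⨆ t ∈ L, V.basicOpen (val t.1)) ∧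
      ∀ t ∈ L, ∃ hj : V.basicOpen (val t.1) ≤ U', ∀ l : Fin n,
        V.presheaf.map (homOfLE (V.basicOpen_le (val t.1))).op (val t.1) ^ t.2.1 *
            V.presheaf.map (homOfLE hj).op (x' l) =
          V.presheaf.map (homOfLE (V.basicOpen_le (val t.1))).op (val (t.2.2.getD l [])) := by
  let G := {t : GluePiece // ∃ hj : V.basicOpen (val t.1) ≤ U', ∀ l : Fin n,
        V.presheaf.map (homOfLE (V.basicOpen_le (val t.1))).op (val t.1) ^ t.2.1 *
            V.presheaf.map (homOfLE hj).op (x' l) =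
          V.presheaf.map (homOfLE (V.basicOpen_le (val t.1))).op (val (t.2.2.getD l []))}
  -- Quasi-separatedness makes the intersection compact, so finitely many of the pieces in `G` cover
  -- it.
  have hcomp : IsCompact ((U ⊓ U' : V.Opens) : Set V) :=
    hU.isCompact.inter_of_isOpen hU'.isCompact U.isOpen U'.isOpen
  obtain ⟨s, hs⟩ := hcomp.elim_finite_subcover (fun t : G => (V.basicOpen (val t.1.1) : Set V))
    (fun t => (V.basicOpen _).isOpen) (by
      rintro v ⟨hv, hv'⟩
      obtain ⟨h, hle, hvh⟩ := hU.exists_basicOpen_le (V := U') ⟨v, hv'⟩ hv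
      obtain ⟨t, rfl, ht⟩ := exists_gluePiece hU val hval x' h hle
      exact Set.mem_iUnion.2 ⟨⟨t, ht⟩, hvh⟩)
  refine ⟨s.toList.map Subtype.val, le_antisymm ?_ ?_, ?_⟩
  · intro v hv
    obtain ⟨t, ht, hvt⟩ := Set.mem_iUnion₂.1 (hs hv)
    refine TopologicalSpace.Opens.mem_iSup.2 ⟨t.1, TopologicalSpace.Opens.mem_iSup.2 ⟨?_, hvt⟩⟩
    exact List.mem_map.2 ⟨t, Finset.mem_toList.2 ht, rfl⟩
  · refine iSup₂_le fun t ht => ?_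
    obtain ⟨t, -, rfl⟩ := List.mem_map.1 ht
    exact le_inf (V.basicOpen_le _) t.2.choose
  · intro t ht
    obtain ⟨t, -, rfl⟩ := List.mem_map.1 ht
    exact t.2

theorem exists_affine_cover (V : Scheme.{0}) [CompactSpace V] :
    ∃ (n : ℕ) (U : Fin n → V.Opens), (∀ i, IsAffineOpen (U i)) ∧ ⨆ i, U i = ⊤ := by
  obtain ⟨s, hs⟩ := isCompact_univ.elim_finite_subcover (fun U : V.affineOpens => (U.1 : Set V))
    (fun U => U.1.isOpen) (by
      have h := congrArg (fun W : V.Opens => (W : Set V)) (iSup_affineOpens_eq_top V)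
      simp only [TopologicalSpace.Opens.coe_iSup, TopologicalSpace.Opens.coe_top] at h
      exact h.ge)
  refine ⟨s.card, fun i => (s.equivFin.symm i).1.1, fun i => (s.equivFin.symm i).1.2, ?_⟩
  refine top_le_iff.1 fun v _ => ?_
  obtain ⟨U, hU, hv⟩ := Set.mem_iUnion₂.1 (hs (Set.mem_univ v))
  exact TopologicalSpace.Opens.mem_iSup.2 ⟨s.equivFin ⟨U, hU⟩, by simpa using hv⟩

open Description in
theorem exists_describes {k : Subring QBar} (hk : Algebra.FiniteType ℤ k) {V : Scheme.{0}}
    (f : V ⟶ specOf k) [IsSeparated f] [LocallyOfFiniteType f] [QuasiCompact f] :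
    ∃ D : Description, D.Describes f := by
  have : IsNoetherianRing k := Algebra.FiniteType.isNoetherianRing ℤ k
  have : CompactSpace V := ⟨f.isCompact_preimage (U := ⊤) isCompact_univ⟩
  have : QuasiSeparatedSpace V := quasiSeparatedSpace_of_quasiSeparated f
  obtain ⟨c, gens, a, hring⟩ := exists_describesRing k hk
  have ha := (hring [] []).2
  obtain ⟨n, U₀, hU₀, hcov₀⟩ := exists_affine_cover V
  choose c₀ hc₀ using fun i => exists_chart f ha (hU₀ i)
  let charts := List.ofFn c₀
  have hlen : charts.length = n := List.length_ofFn
  let U : Fin charts.length → V.Opens := fun i => U₀ (i.cast hlen)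
  have hcov : ⨆ i, U i = ⊤ := by
    rw [← hcov₀]
    exact (finCongr hlen).surjective.iSup_comp U₀
  have hchart : ∀ i : Fin charts.length, ∃ x : Fin (charts.get i).1 → Γ(V, U i),
      Function.Surjective (coordHom f (U i) x) ∧ RingHom.ker (coordHom f (U i) x) =
        Ideal.span {F | ∃ P ∈ (charts.get i).2, F = toMvPolynomial a (charts.get i).1 P} := by
    intro i
    have h : charts.get i = c₀ (i.cast hlen) := List.get_ofFn c₀ i
    rw [h]
    exact hc₀ _
  choose x hx hker using hchart
  let val : ∀ i, SparsePoly → Γ(V, U i) := fun i P =>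
    coordHom f (U i) (x i) (toMvPolynomial a (charts.get i).1 P)
  have hval : ∀ i, Function.Surjective (val i) := fun i =>
    (hx i).comp (exists_toMvPolynomial_eq a ha _)
  choose L hL using fun i j => exists_gluePieces (hU₀ (Fin.cast hlen i)) (hU₀ (Fin.cast hlen j))
    (val i) (hval i) (x j)
  let D : Description := ⟨c, gens, charts, List.ofFn fun i => List.ofFn fun j => L i j⟩
  have hD : ∀ i j : Fin D.numCharts, D.gluePieces i j = L i j := by
    intro i j
    simp [D, Description.gluePieces]
  refine ⟨D, a, U, x, hring _ _, fun i => hU₀ _, hcov, hx, hker, fun i j => ?_⟩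
  rw [hD]
  exact hL i j

end

theorem theorem1p2 :
    ∃ C : Description → ℕ, Computable C ∧
      ∀ (k : Subring QBar), Algebra.FiniteType ℤ k →
      ∀ (V : Scheme.{0}) (f : V ⟶ specOf k),
        IsReduced V → IsSeparated f → LocallyOfFiniteType f → QuasiCompact f →
        (∃ D : Description, D.Describes f) ∧
        ∀ D : Description, D.Describes f →
          ∀ O : Set (KPoints f), O.Finite →
            Finite (ConfigAut f O) ∧ Nat.card (ConfigAut f O) ≤ C D := by
  refine ⟨Description.autBound, Description.computable_autBound, fun k hk V f _ _ _ _ =>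
    ⟨exists_describes hk f, fun D hD O hO => ?_⟩⟩
  have : IsNoetherianRing k := Algebra.FiniteType.isNoetherianRing ℤ k
  exact hD.card_configAut_le O hO
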